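/- **Definitions.** Let $n\ge 2$ and let $\pi_k(z_1,\dots,z_k)=\big(\sum_i z_i,\ \sum_{i<j}z_iz_j,\ \dots,\ z_1\cdots z_k\big)$; put $\mathbb G_k=\pi_k(\mathbb D^k)$ and $\Gamma_k=\pi_k(\overline{\mathbb D}^{\,k})$. Write $\sigma_T$ for the Taylor joint spectrum. * The distinguished boundary $b\Gamma_n$ is the Shilov boundary of the algebra of rational functions on $\Gamma_n$, i.e. the intersection of all closed subsets of $\Gamma_n$ on which every quotient of polynomials, with denominator zero-free on $\Gamma_n$, attains its maximum modulus over $\Gamma_n$. * A distinguished variety in $\mathbb G_n$ is a set $\Lambda\subseteq\mathbb G_n$ that is the intersection of $\mathbb G_n$ with the common zero set of a set of polynomials and satisfies $\overline\Lambda\cap\partial\Gamma_n=\overline\Lambda\cap b\Gamma_n$. * A $\Gamma_k$-contraction is a commuting tuple $T=(T_1,\dots,T_k)$ of bounded operators on a complex Hilbert space with $\sigma_T(T)\subseteq\Gamma_k$ and $\|f(T)\|\le\sup_{\Gamma_k}|f|$ for every polynomial $f$ in $k$ variables. A $\Gamma_n$-contraction $(S_1,\dots,S_{n-1},P)$ is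 pure if $P^{*j}\to0$ strongly as $j\to\infty$. * For a contraction $P$ let $D_P=(I-P^*P)^{1/2}$ and let $\mathcal D_P$ be the closure of its range. The fundamental operator tuple of a $\Gamma_n$-contraction $(S_1,\dots,S_{n-1},P)$ is the tuple of bounded operators $F_1,\dots,F_{n-1}$ on $\mathcal D_P$ with $S_i-S_{n-i}^*P=D_PF_iD_P$ for $1\le i\le n-1$. **Theorem.** Let $\Sigma=(S_1,\dots,S_{n-1},P)$ be a $\Gamma_n$-contraction on a nonzero complex Hilbert space such that $(S_1^*,\dots,S_{n-1}^*,P^*)$ is a pure $\Gamma_n$-contraction and $\dim\mathcal D_P<\infty$. Suppose that its fundamental operator tuple $(F_1,\dots,F_{n-1})$ satisfies 1. $\left(\frac{n-1}{n}(F_1^*+F_{n-1}z),\ \frac{n-2}{n}(F_2^*+F_{n-2}z),\ \dots,\ \frac1n(F_{n-1}^*+F_1z)\right)$ is a $\Gamma_{n-1}$-contraction for every $z\in\overline{\mathbb D}$; 2. $\sigma_T(F_1,\dots,F_{n-1})\subseteq\mathbb G_{n-1}$. Let $$\Lambda_\Sigma=\{(s_1,\dots,s_{n-1},p)\in\mathbb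 G_n:(s_1,\dots,s_{n-1})\in\sigma_T(F_1+pF_{n-1}^*,\dots,F_{n-1}+pF_1^*)\},$$ $$\Lambda_\Sigma^*=\{(s_1,\dots,s_{n-1},p)\in\mathbb G_n:(s_1,\dots,s_{n-1})\in\sigma_T(F_1^*+pF_{n-1},\dots,F_{n-1}^*+pF_1)\}.$$ Then $\Lambda_\Sigma$ and $\Lambda_\Sigma^*$ are distinguished varieties in $\mathbb G_n$, and for every scalar polynomial and every square-matrix-valued polynomial $f$ in $n$ variables $$\|f(S_1,\dots,S_{n-1},P)\|\le\max_{(s_1,\dots,s_{n-1},p)\in\overline{\Lambda_\Sigma}}\|f(s_1,\dots,s_{n-1},p)\|,$$ where the maximum is attained, norms of matrices are Euclidean operator norms, and for a $k\times k$ matrix-valued $f$ the left side is the operator norm on the direct sum of $k$ copies of the Hilbert space. -/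

import Mathlib

open scoped TensorProduct

namespace SymPolydisc

noncomputable section

/-! ### The symmetrized polydisc -/

/-- The symmetrization map `π_n` on `ℂⁿ`: its `k`-th coordinate (counted from `0`) is the
elementary symmetric polynomial of degree `k + 1`. The last coordinate is the product. -/
def symMap (n : ℕ) (z : Fin n → ℂ) : Fin n → ℂ := fun k =>
  ∑ t ∈ Finset.powersetCard ((k : ℕ) + 1) (Finset.univ : Finset (Fin n)), ∏ i ∈ t, z i

/-- The open symmetrized polydisc `𝔾_n`. -/
def openSym (n : ℕ) : Set (Fin n → ℂ) := symMap n '' {z | ∀ i, ‖z i‖ < 1}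

/-- The closed symmetrized polydisc `Γ_n`. -/
def closedSym (n : ℕ) : Set (Fin n → ℂ) := symMap n '' {z | ∀ i, ‖z i‖ ≤ 1}

/-- `δ` is a boundary for the algebra of rational functions on `X`: a closed subset of `X` on
which every quotient `a / b` of polynomials, `b` without zeros in `X`, attains its maximum
modulus over `X`. -/
def IsBoundary {n : ℕ} (X δ : Set (Fin n → ℂ)) : Prop :=
  IsClosed δ ∧ δ ⊆ X ∧
    ∀ a b : MvPolynomial (Fin n) ℂ, (∀ x ∈ X, MvPolynomial.eval x b ≠ 0) →
      ∃ x ∈ δ, ∀ y ∈ X,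
        ‖MvPolynomial.eval y a / MvPolynomial.eval y b‖ ≤
          ‖MvPolynomial.eval x a / MvPolynomial.eval x b‖

/-- The distinguished boundary `bX` of a compact set `X ⊆ ℂⁿ`: the Shilov boundary of the algebra
of rational functions on `X`, i.e. the intersection of all its boundaries. -/
def distinguishedBoundary {n : ℕ} (X : Set (Fin n → ℂ)) : Set (Fin n → ℂ) :=
  ⋂₀ {δ | IsBoundary X δ}

/-- `L` is an algebraic variety in the domain `G ⊆ ℂⁿ`: the part in `G` of the common zero set
of a set of polynomials. -/
def IsVarietyIn {n : ℕ} (G L : Set (Fin n → ℂ)) : Prop :=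
  ∃ A : Set (MvPolynomial (Fin n) ℂ), L = {x | x ∈ G ∧ ∀ q ∈ A, MvPolynomial.eval x q = 0}

/-- Distinguished varieties in `𝔾_n`. -/
def IsDistinguishedVariety {n : ℕ} (L : Set (Fin n → ℂ)) : Prop :=
  IsVarietyIn (openSym n) L ∧
    closure L ∩ frontier (closedSym n) = closure L ∩ distinguishedBoundary (closedSym n)

/-! ### Taylor joint spectrum -/

/-- The Koszul operator `D_T = ∑ i, T_i ⊗ E_i` on `X ⊗ Λ`, where `Λ` is the exterior algebra on
`n` generators `e_1, …, e_n` and `E_i` is left multiplication by `e_i`. -/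
def koszul {n : ℕ} {X : Type*} [AddCommGroup X] [Module ℂ X] (T : Fin n → (X →ₗ[ℂ] X)) :
    (X ⊗[ℂ] ExteriorAlgebra ℂ (Fin n → ℂ)) →ₗ[ℂ] (X ⊗[ℂ] ExteriorAlgebra ℂ (Fin n → ℂ)) :=
  ∑ i, TensorProduct.map (T i)
    (LinearMap.mulLeft ℂ (ExteriorAlgebra.ι ℂ (Pi.single i (1 : ℂ) : Fin n → ℂ)))

/-- The Taylor joint spectrum of a (commuting) tuple: the points `l` for which the range of the
Koszul operator of `T - l` is not equal to its kernel. -/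
def taylorSpectrum {n : ℕ} {X : Type*} [NormedAddCommGroup X] [NormedSpace ℂ X]
    (T : Fin n → (X →L[ℂ] X)) : Set (Fin n → ℂ) :=
  {l | LinearMap.range (koszul fun i => ((T i - l i • 1 : X →L[ℂ] X) : X →ₗ[ℂ] X)) ≠
    LinearMap.ker (koszul fun i => ((T i - l i • 1 : X →L[ℂ] X) : X →ₗ[ℂ] X))}

/-! ### Polynomials of operator tuples -/

/-- `f(T_1, …, T_n)` for a (commuting) tuple of operators and a scalar polynomial `f`. -/
def polyOp {n : ℕ} {X : Type*} [NormedAddCommGroup X] [NormedSpace ℂ X]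
    (T : Fin n → (X →L[ℂ] X)) (f : MvPolynomial (Fin n) ℂ) : X →L[ℂ] X :=
  ∑ d ∈ f.support, MvPolynomial.coeff d f • (List.ofFn fun i => T i ^ d i).prod

/-- The operator on the Hilbert space direct sum `X ⊕ ⋯ ⊕ X` (`k` copies) given by a `k × k`
matrix of operators on `X`. -/
def blockOp {k : ℕ} {X : Type*} [NormedAddCommGroup X] [NormedSpace ℂ X]
    (A : Matrix (Fin k) (Fin k) (X →L[ℂ] X)) :
    PiLp 2 (fun _ : Fin k => X) →L[ℂ] PiLp 2 (fun _ : Fin k => X) :=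
  ((PiLp.continuousLinearEquiv 2 ℂ (fun _ : Fin k => X)).symm :
      (Fin k → X) →L[ℂ] PiLp 2 (fun _ : Fin k => X)) ∘L
    (ContinuousLinearMap.pi fun i => ∑ j, A i j ∘L ContinuousLinearMap.proj j) ∘L
    ((PiLp.continuousLinearEquiv 2 ℂ (fun _ : Fin k => X)) :
      PiLp 2 (fun _ : Fin k => X) →L[ℂ] (Fin k → X))

/-- `f(T_1, …, T_n)` for a matrix-valued polynomial `f`, that is, a `k × k` matrix of scalar
polynomials. -/
def matPolyOp {n k : ℕ} {X : Type*} [NormedAddCommGroup X] [NormedSpace ℂ X]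
    (T : Fin n → (X →L[ℂ] X)) (f : Matrix (Fin k) (Fin k) (MvPolynomial (Fin n) ℂ)) :
    PiLp 2 (fun _ : Fin k => X) →L[ℂ] PiLp 2 (fun _ : Fin k => X) :=
  blockOp (f.map (polyOp T))

/-- The operator norm (for the Euclidean norm on `ℂᵏ`) of the value of a matrix-valued polynomial
at a point. -/
def matPolyNorm {n k : ℕ} (f : Matrix (Fin k) (Fin k) (MvPolynomial (Fin n) ℂ))
    (x : Fin n → ℂ) : ℝ :=
  ‖Matrix.toEuclideanCLM (n := Fin k) (𝕜 := ℂ) (f.map (MvPolynomial.eval x))‖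

/-! ### `Γ_n`-contractions -/

/-- `Γ_n`-contractions: commuting tuples with `Γ_n` as a spectral set. -/
def IsGammaContraction {n : ℕ} {X : Type*} [NormedAddCommGroup X] [NormedSpace ℂ X]
    (T : Fin n → (X →L[ℂ] X)) : Prop :=
  (∀ i j, Commute (T i) (T j)) ∧ taylorSpectrum T ⊆ closedSym n ∧
    ∀ f : MvPolynomial (Fin n) ℂ,
      ‖polyOp T f‖ ≤ sSup ((fun x => ‖MvPolynomial.eval x f‖) '' closedSym n)

variable {H : Type*} [NormedAddCommGroup H] [InnerProductSpace ℂ H] [CompleteSpace H]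

/-- `(S_1, …, S_m, P)` is a pure `Γ_{m+1}`-contraction: a `Γ_{m+1}`-contraction for which
`(P^*)^k → 0` strongly. -/
def IsPureGammaContraction {m : ℕ} (S : Fin m → (H →L[ℂ] H)) (P : H →L[ℂ] H) : Prop :=
  IsGammaContraction (Fin.snoc S P : Fin (m + 1) → (H →L[ℂ] H)) ∧
    ∀ h : H, Filter.Tendsto (fun k : ℕ => (ContinuousLinearMap.adjoint P ^ k) h)
      Filter.atTop (nhds 0)

/-- The defect operator `D_P = (I - P^* P)^{1/2}` (of a contraction `P`). -/
def defectOp (P : H →L[ℂ] H) : H →L[ℂ] H :=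
  CFC.sqrt (1 - ContinuousLinearMap.adjoint P * P)

/-- The defect space `𝒟_P`, the closure of the range of `D_P`. -/
abbrev defectSpace (P : H →L[ℂ] H) : Submodule ℂ H :=
  (LinearMap.range (defectOp P : H →ₗ[ℂ] H)).topologicalClosure

/-- `D_P` as an operator from `H` to `𝒟_P`. -/
def defectMap (P : H →L[ℂ] H) : H →L[ℂ] defectSpace P :=
  (defectOp P).codRestrict (defectSpace P) fun h =>
    Submodule.le_topologicalClosure _ (LinearMap.mem_range_self (defectOp P : H →ₗ[ℂ] H) h)

/-- `F` is the fundamental operator tuple of `(S_1, …, S_{n-1}, P)`, `n = m + 1`: the operators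
`F_i` on `𝒟_P` satisfy `S_i - S_{n-i}^* P = D_P F_i D_P`. Indices are shifted by one, so that
`i ↦ n - i` becomes `Fin.rev`. -/
def IsFundamentalTuple {m : ℕ} (S : Fin m → (H →L[ℂ] H)) (P : H →L[ℂ] H)
    (F : Fin m → (defectSpace P →L[ℂ] defectSpace P)) : Prop :=
  ∀ i, S i - ContinuousLinearMap.adjoint (S i.rev) * P =
    defectOp P ∘L (defectSpace P).subtypeL ∘L F i ∘L defectMap P

/-- For operators `F_1, …, F_{n-1}`, `n = m + 1`, the set of `(s_1, …, s_{n-1}, p) ∈ 𝔾_n` with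
`(s_1, …, s_{n-1}) ∈ σ_T(F_1 + p F_{n-1}^*, …, F_{n-1} + p F_1^*)`. -/
def fiberVariety {m : ℕ} (F : Fin m → (H →L[ℂ] H)) : Set (Fin (m + 1) → ℂ) :=
  {x | x ∈ openSym (m + 1) ∧
    (fun i : Fin m => x i.castSucc) ∈
      taylorSpectrum fun i => F i + x (Fin.last m) • ContinuousLinearMap.adjoint (F i.rev)}

/-- For operators `F_1, …, F_{n-1}`, `n = m + 1`, the set of `(s_1, …, s_{n-1}, p) ∈ 𝔾_n` with
`(s_1, …, s_{n-1}) ∈ σ_T(F_1^* + p F_{n-1}, …, F_{n-1}^* + p F_1)`. -/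
def adjointFiberVariety {m : ℕ} (F : Fin m → (H →L[ℂ] H)) : Set (Fin (m + 1) → ℂ) :=
  {x | x ∈ openSym (m + 1) ∧
    (fun i : Fin m => x i.castSucc) ∈
      taylorSpectrum fun i => ContinuousLinearMap.adjoint (F i) + x (Fin.last m) • F i.rev}

end

end SymPolydisc

/-! Put `E = 𝒟_P` and consider the pencil `T_i(p) = F_i + p F_{n-i}^*` on the finite-dimensional
space `E`. There the Taylor spectrum of a commuting tuple is its set of joint eigenvalues
(`mem_taylorSpectrum_iff`), and `x` lies in `Γ_n` or `𝔾_n` iff `1 - x_1 u + x_2 u² - ⋯` has no zero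
in the open or closed unit disc (`mem_closedSym_iff`, `mem_openSym_iff`).

Geometry. For `|p| = 1` one has `T_i = p T_{n-i}^*`, so a joint eigenvalue `s` satisfies `s_i = p *
conj s_{n-i}` and the polynomial of `(s, p)` is self-inversive. Hypothesis 1 locates the zeros of
its derivative, and Cohn's theorem (`snoc_mem_torusSym`) puts `(s, p)` in the image of the torus.
This image is `bΓ_n` (`distinguishedBoundary_closedSym`). Hypothesis 2 settles `p = 0`. A
zero-counting argument for the determinant of `genOp`, a polynomial of bounded degree in `p`, then
carries the joint eigenvalues over `|p| < 1` into `𝔾_n` (`ne_zero_of_boundary_zero_free`). The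
closure of the variety can therefore leave `𝔾_n` only over the circle, hence only in `bΓ_n`.
Hypothesis 1 speaks of the pencil `F_i^* + p F_{n-i}`; taking adjoints gives the other one.

Inequality. Purity of the adjoint tuple says `P^k → 0` strongly, so `h ↦ (D_P P^k h)_k` is an
isometry into the square-summable sequences in `E`. By `D_P S_i = F_i D_P + F_{n-i}^* D_P P` it
intertwines `S_i` with `T_i(backward shift)`. Thus `‖f(S, P)‖` is at most the supremum over `|p| =
1` of `‖f(T(p), p)‖`; a finite Fourier transform replaces Hardy space theory here
(`norm_matPolyOp_le_of_model`). On the circle `T(p)` is a commuting normal tuple, so that norm is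
controlled by the values of `f` at joint eigenvalues, and bounds on the variety persist there
(`IsDistinguishedPencil.norm_eval_le`). -/

namespace SymPolydisc

/-! ### Joint eigenvalues of commuting tuples in finite dimension. -/

section JointEigenvalue

variable {ι X : Type*} [AddCommGroup X] [Module ℂ X]

/-- `s` is a joint eigenvalue of the tuple `T`. -/
def IsJointEigenvalue (T : ι → Module.End ℂ X) (s : ι → ℂ) : Prop :=
  ∃ v : X, v ≠ 0 ∧ ∀ i, T i v = s i • v

/-- A commuting finite tuple has a joint eigenvector in every nonzero invariant subspace. -/
theorem exists_jointEigenvector_mem [Finite ι] [FiniteDimensional ℂ X] (T : ι → Module.End ℂ X)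
    (hT : ∀ i j, Commute (T i) (T j)) (W : Submodule ℂ X) (hW : W ≠ ⊥)
    (hinv : ∀ i, ∀ w ∈ W, T i w ∈ W) :
    ∃ v ∈ W, v ≠ 0 ∧ ∃ s : ι → ℂ, ∀ i, T i v = s i • v := by
  classical
  have := Fintype.ofFinite ι
  -- Cut `W` down by one eigenspace per coordinate; commutativity keeps the intersection invariant
  -- under the whole tuple.
  have key : ∀ t : Finset ι, ∃ W' ≤ W, W' ≠ ⊥ ∧ (∀ i, ∀ w ∈ W', T i w ∈ W') ∧
      ∃ s : ι → ℂ, ∀ i ∈ t, ∀ w ∈ W', T i w = s i • w := by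
    intro t
    induction t using Finset.induction_on with
    | empty => exact ⟨W, le_rfl, hW, hinv, 0, by simp⟩
    | insert i t hi ih =>
      obtain ⟨W', hle, hne, hin, s, hs⟩ := ih
      have : Nontrivial W' := Submodule.nontrivial_iff_ne_bot.mpr hne
      obtain ⟨μ, hμ⟩ := Module.End.exists_eigenvalue ((T i).restrict (hin i))
      obtain ⟨w, hw⟩ := hμ.exists_hasEigenvector
      have hTw : T i w = μ • (w : X) := by
        have := congrArg Subtype.val hw.apply_eq_smul
        simpa using this
      refine ⟨W' ⊓ Module.End.eigenspace (T i) μ, inf_le_left.trans hle, ?_, ?_,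
        Function.update s i μ, ?_⟩
      · intro h
        have hmem : (w : X) ∈ W' ⊓ Module.End.eigenspace (T i) μ :=
          ⟨w.2, Module.End.mem_eigenspace_iff.mpr hTw⟩
        rw [h, Submodule.mem_bot] at hmem
        exact hw.2 (Subtype.ext hmem)
      · rintro j x ⟨hx, hx'⟩
        refine ⟨hin j x hx, ?_⟩
        rw [SetLike.mem_coe, Module.End.mem_eigenspace_iff] at hx' ⊢
        have := LinearMap.congr_fun (hT i j).eq x
        simp only [Module.End.mul_apply] at this
        rw [this, hx', map_smul]
      · rintro j hj x ⟨hx, hx'⟩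
        rw [SetLike.mem_coe, Module.End.mem_eigenspace_iff] at hx'
        by_cases hji : j = i
        · subst hji; simpa using hx'
        · rw [Function.update_of_ne hji]
          exact hs j (Finset.mem_of_mem_insert_of_ne hj hji) x hx
  obtain ⟨W', hle, hne, -, s, hs⟩ := key Finset.univ
  obtain ⟨v, hv, hv0⟩ := Submodule.exists_mem_ne_zero_of_ne_bot hne
  exact ⟨v, hle hv, hv0, s, fun i => hs i (Finset.mem_univ i) v hv⟩

theorem finite_setOf_isJointEigenvalue [Finite ι] [FiniteDimensional ℂ X]
    (T : ι → Module.End ℂ X) : {s | IsJointEigenvalue T s}.Finite := by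
  refine (Set.Finite.pi' fun i => Module.End.finite_hasEigenvalue (T i)).subset ?_
  rintro s ⟨v, hv, hs⟩ i
  exact Module.End.hasEigenvalue_of_hasEigenvector (x := v)
    ⟨Module.End.mem_eigenspace_iff.mpr (hs i), hv⟩

/-- Finitely many nonzero vectors of `ℂᵐ` are avoided by a hyperplane. -/
theorem exists_linear_ne_zero {m : ℕ} {A : Set (Fin m → ℂ)} (hA : A.Finite)
    (h0 : ∀ s ∈ A, s ≠ 0) : ∃ a : Fin m → ℂ, ∀ s ∈ A, ∑ i, a i * s i ≠ 0 := by
  -- The functional is sought on the moment curve `a_i = t ^ i`. Each `s` then excludes only the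
  -- finitely many roots `t` of `q s`.
  let q : (Fin m → ℂ) → Polynomial ℂ := fun s =>
    ∑ i : Fin m, Polynomial.C (s i) * Polynomial.X ^ (i : ℕ)
  have hq : ∀ s ∈ A, q s ≠ 0 := by
    intro s hs h
    apply h0 s hs
    funext j
    have := congrArg (fun f => Polynomial.coeff f (j : ℕ)) h
    simpa [q, Polynomial.finsetSum_coeff, Polynomial.coeff_C_mul, Polynomial.coeff_X_pow,
      Fin.val_inj] using this
  have hfin : (⋃ s ∈ A, {t : ℂ | (q s).IsRoot t}).Finite :=
    hA.biUnion fun s hs => Polynomial.finite_setOfPred_isRoot (hq s hs)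
  obtain ⟨t, ht⟩ := hfin.infinite_compl.nonempty
  refine ⟨fun i => t ^ (i : ℕ), fun s hs h => ht ?_⟩
  simp only [Set.mem_iUnion]
  refine ⟨s, hs, ?_⟩
  simp only [Set.mem_ofPred_eq, Polynomial.IsRoot, q, Polynomial.eval_finsetSum]
  rw [← h]
  exact Finset.sum_congr rfl fun i _ => by
    rw [Polynomial.eval_mul, Polynomial.eval_C, Polynomial.eval_pow, Polynomial.eval_X, mul_comm]

/-- A commuting tuple without joint kernel has an invertible linear combination. -/
theorem exists_isUnit_linearCombination {m : ℕ} [FiniteDimensional ℂ X]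
    (T : Fin m → Module.End ℂ X) (hT : ∀ i j, Commute (T i) (T j))
    (h0 : ∀ v, (∀ i, T i v = 0) → v = 0) : ∃ a : Fin m → ℂ, IsUnit (∑ i, a i • T i) := by
  obtain ⟨a, ha⟩ := exists_linear_ne_zero (finite_setOf_isJointEigenvalue T) (by
    rintro s ⟨v, hv, hs⟩ rfl
    exact hv (h0 v fun i => by simpa using hs i))
  refine ⟨a, ?_⟩
  -- If the combination had a kernel, this invariant subspace would contain a joint eigenvector,
  -- whose eigenvalue `s` would satisfy `∑ a_i s_i = 0`, against the choice of `a`.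
  rw [LinearMap.isUnit_iff_ker_eq_bot]
  by_contra hne
  obtain ⟨v, hv, hv0, s, hs⟩ := exists_jointEigenvector_mem T hT _ hne (by
    intro i w hw
    rw [LinearMap.mem_ker] at hw ⊢
    have hc : Commute (∑ j, a j • T j) (T i) :=
      Commute.sum_left _ _ _ fun j _ => (hT j i).smul_left _
    have := LinearMap.congr_fun hc.eq w
    simp only [Module.End.mul_apply] at this
    rw [this, hw, map_zero])
  have h1 : (∑ i, a i * s i) • v = 0 := by
    rw [LinearMap.mem_ker] at hv
    rw [← hv, Finset.sum_smul, LinearMap.sum_apply]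
    exact Finset.sum_congr rfl fun i _ => by simp [hs i, mul_smul]
  exact (smul_ne_zero (ha s ⟨v, hv0, hs⟩) hv0) h1

/-- Joint eigenvalues of a commuting tuple are detected by linear combinations. -/
theorem isJointEigenvalue_iff {m : ℕ} [FiniteDimensional ℂ X]
    (T : Fin m → Module.End ℂ X) (hT : ∀ i j, Commute (T i) (T j)) (s : Fin m → ℂ) :
    IsJointEigenvalue T s ↔ ∀ a : Fin m → ℂ, ¬ IsUnit (∑ i, a i • (T i - s i • 1)) := by
  constructor
  · rintro ⟨v, hv, hs⟩ a hu
    rw [LinearMap.isUnit_iff_ker_eq_bot] at hu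
    apply hv
    rw [← Submodule.mem_bot ℂ, ← hu, LinearMap.mem_ker, LinearMap.sum_apply]
    exact Finset.sum_eq_zero fun i _ => by simp [hs i]
  · intro h
    by_contra hne
    obtain ⟨a, ha⟩ := exists_isUnit_linearCombination (fun i => T i - s i • 1)
      (fun i j => by
        have h1 : ∀ (c : ℂ) (A : Module.End ℂ X), Commute A (c • 1) := fun c A =>
          (Commute.one_right A).smul_right c
        exact ((hT i j).sub_right (h1 _ _)).sub_left
          (((h1 _ _).symm).sub_right (h1 _ _)))
      (fun v hv => by
        by_contra hv0
        exact hne ⟨v, hv0, fun i => by simpa [sub_eq_zero] using hv i⟩)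
    exact h a ha

end JointEigenvalue

/-! ### Exactness of the Koszul complex. -/

section Koszul

variable {X : Type*} [AddCommGroup X] [Module ℂ X]

theorem koszul_tmul {n : ℕ} (T : Fin n → (X →ₗ[ℂ] X)) (x : X)
    (w : ExteriorAlgebra ℂ (Fin n → ℂ)) :
    koszul T (x ⊗ₜ[ℂ] w) = ∑ i, T i x ⊗ₜ[ℂ]
      (ExteriorAlgebra.ι ℂ (Pi.single i (1 : ℂ) : Fin n → ℂ) * w) := by
  simp [koszul, LinearMap.sum_apply]

theorem koszul_comp_koszul {n : ℕ} (T : Fin n → (X →ₗ[ℂ] X))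
    (hT : ∀ i j, Commute (T i) (T j)) : koszul T ∘ₗ koszul T = 0 := by
  refine TensorProduct.ext' fun x w => ?_
  simp only [LinearMap.comp_apply, koszul_tmul, map_sum, LinearMap.zero_apply]
  set e : Fin n → ExteriorAlgebra ℂ (Fin n → ℂ) := fun i =>
    ExteriorAlgebra.ι ℂ (Pi.single i (1 : ℂ))
  have hneg : ∀ i j, T j (T i x) ⊗ₜ[ℂ] (e j * (e i * w)) =
      -(T i (T j x) ⊗ₜ[ℂ] (e i * (e j * w))) := by
    intro i j
    have h1 : T j (T i x) = T i (T j x) := LinearMap.congr_fun (hT j i).eq x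
    have h2 : e j * e i = -(e i * e j) :=
      eq_neg_of_add_eq_zero_left (ExteriorAlgebra.ι_add_mul_swap _ _)
    rw [h1, ← mul_assoc, h2, neg_mul, TensorProduct.tmul_neg, mul_assoc]
  -- Swapping the two summation indices changes the sign of the double sum, so it equals its own
  -- negative.
  have h : ∀ S : X ⊗[ℂ] ExteriorAlgebra ℂ (Fin n → ℂ), S = -S → S = 0 := fun S hS => by
    have h2 : (2 : ℂ) • S = 0 := by rw [two_smul]; nth_rewrite 1 [hS]; simp
    exact (smul_eq_zero.mp h2).resolve_left two_ne_zero
  apply h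
  rw [← Finset.sum_neg_distrib]
  nth_rewrite 1 [Finset.sum_comm]
  refine Finset.sum_congr rfl fun i _ => ?_
  rw [← Finset.sum_neg_distrib]
  exact Finset.sum_congr rfl fun j _ => hneg j i

/-- An explicit contracting homotopy: the inverse `G` of `∑ a_i T_i`, tensored with the contraction
by the functional `e_i ↦ a_i`. Its anticommutator with the Koszul operator is `(∑ a_i T_i) G = 1`.
-/
theorem koszul_exact_of_isUnit {n : ℕ} (T : Fin n → (X →ₗ[ℂ] X))
    (hT : ∀ i j, Commute (T i) (T j)) (a : Fin n → ℂ)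
    (hu : IsUnit (∑ i, a i • T i : Module.End ℂ X)) :
    LinearMap.range (koszul T) = LinearMap.ker (koszul T) := by
  apply le_antisymm
  · rintro _ ⟨y, rfl⟩
    exact LinearMap.congr_fun (koszul_comp_koszul T hT) y
  obtain ⟨L, hL⟩ := hu
  set G : Module.End ℂ X := ↑L⁻¹
  have hcomm : ∀ i, Commute (T i) G := fun i => by
    have h : Commute (T i) (L : Module.End ℂ X) := by
      rw [hL]
      exact Commute.sum_right _ _ _ fun j _ => (hT i j).smul_right _
    exact h.units_inv_right
  have hGL : ∀ x, G (∑ i, a i • T i x) = x := fun x => by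
    have h : G * (∑ i, a i • T i : Module.End ℂ X) = 1 := by rw [← hL]; exact L.inv_mul
    simpa [LinearMap.sum_apply] using LinearMap.congr_fun h x
  let d : Module.Dual ℂ (Fin n → ℂ) := ∑ i, a i • LinearMap.proj i
  have hd : ∀ i, d (Pi.single i 1) = a i := fun i => by
    simp [d, LinearMap.sum_apply, Pi.single_apply]
  let κ : Module.End ℂ (ExteriorAlgebra ℂ (Fin n → ℂ)) :=
    CliffordAlgebra.contractLeft (Q := (0 : QuadraticForm ℂ (Fin n → ℂ))) d
  have hκ : ∀ i (w : ExteriorAlgebra ℂ (Fin n → ℂ)),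
      κ (ExteriorAlgebra.ι ℂ (Pi.single i (1 : ℂ) : Fin n → ℂ) * w) =
        a i • w - ExteriorAlgebra.ι ℂ (Pi.single i (1 : ℂ) : Fin n → ℂ) * κ w := fun i w => by
    have := CliffordAlgebra.contractLeft_ι_mul (Q := (0 : QuadraticForm ℂ (Fin n → ℂ))) (d := d)
      (Pi.single i 1) w
    rw [hd] at this
    exact this
  let h := TensorProduct.map G κ
  have hom : koszul T ∘ₗ h + h ∘ₗ koszul T = LinearMap.id := by
    refine TensorProduct.ext' fun x w => ?_
    simp only [LinearMap.add_apply, LinearMap.comp_apply, koszul_tmul, map_sum, h,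
      TensorProduct.map_tmul, LinearMap.id_apply, hκ, TensorProduct.tmul_sub]
    rw [Finset.sum_sub_distrib]
    have h1 : ∀ i, T i (G x) = G (T i x) := fun i => LinearMap.congr_fun (hcomm i).eq x
    simp only [h1]
    rw [add_sub_cancel]
    have h2 : ∀ i, G (T i x) ⊗ₜ[ℂ] (a i • w) = (a i • G (T i x)) ⊗ₜ[ℂ] w := fun i => by
      rw [TensorProduct.smul_tmul]
    simp only [h2]
    rw [← TensorProduct.sum_tmul]
    congr 1
    simpa using hGL x
  intro y hy
  refine ⟨h y, ?_⟩
  have := LinearMap.congr_fun hom y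
  rw [LinearMap.mem_ker] at hy
  simpa [hy] using this

/-- The vector `v ⊗ 1` is a cycle of degree zero, while every boundary has vanishing degree-zero
part. -/
theorem koszul_not_exact {n : ℕ} (T : Fin n → (X →ₗ[ℂ] X)) {v : X} (hv : v ≠ 0)
    (h0 : ∀ i, T i v = 0) : LinearMap.range (koszul T) ≠ LinearMap.ker (koszul T) := by
  intro h
  have hmem : v ⊗ₜ[ℂ] (1 : ExteriorAlgebra ℂ (Fin n → ℂ)) ∈ LinearMap.ker (koszul T) := by
    rw [LinearMap.mem_ker, koszul_tmul]
    exact Finset.sum_eq_zero fun i _ => by simp [h0 i]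
  rw [← h] at hmem
  obtain ⟨y, hy⟩ := hmem
  let φ : X ⊗[ℂ] ExteriorAlgebra ℂ (Fin n → ℂ) →ₗ[ℂ] X :=
    (TensorProduct.rid ℂ X).toLinearMap ∘ₗ
      TensorProduct.map LinearMap.id (ExteriorAlgebra.algebraMapInv (R := ℂ)).toLinearMap
  have hφ : φ ∘ₗ koszul T = 0 := by
    refine TensorProduct.ext' fun x w => ?_
    simp [φ, koszul_tmul, ExteriorAlgebra.algebraMapInv]
  have := congrArg φ hy
  rw [← LinearMap.comp_apply, hφ] at this
  apply hv
  simpa [φ] using this.symm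

end Koszul

/-- On a finite-dimensional space the Taylor spectrum is the set of joint eigenvalues. -/
theorem mem_taylorSpectrum_iff {n : ℕ} {X : Type*} [NormedAddCommGroup X] [NormedSpace ℂ X]
    [FiniteDimensional ℂ X] (T : Fin n → (X →L[ℂ] X)) (hT : ∀ i j, Commute (T i) (T j))
    (s : Fin n → ℂ) :
    s ∈ taylorSpectrum T ↔ IsJointEigenvalue (fun i => (T i : Module.End ℂ X)) s := by
  have hT' : ∀ i j, Commute (T i : Module.End ℂ X) (T j : Module.End ℂ X) := fun i j => by
    ext x
    exact DFunLike.congr_fun (hT i j).eq x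
  have hco : (fun i => ((T i - s i • 1 : X →L[ℂ] X) : X →ₗ[ℂ] X)) =
      fun i => (T i : Module.End ℂ X) - s i • 1 := by
    funext i; ext x; simp
  rw [taylorSpectrum, Set.mem_ofPred_eq, hco]
  constructor
  · intro h
    -- If no joint eigenvector existed, some linear combination of the `T i - s i` would be
    -- invertible and the complex exact.
    rw [isJointEigenvalue_iff _ hT']
    intro a ha
    refine h (koszul_exact_of_isUnit _ (fun i j => ?_) a ha)
    have h1 : ∀ (c : ℂ) (A : Module.End ℂ X), Commute A (c • 1) := fun c A =>
      (Commute.one_right A).smul_right c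
    exact ((hT' i j).sub_right (h1 _ _)).sub_left (((h1 _ _).symm).sub_right (h1 _ _))
  · rintro ⟨v, hv, hs⟩
    exact koszul_not_exact _ hv fun i => by simp [hs i]

/-! ### The generating polynomial of a point -/

/-- The polynomial `u ↦ 1 - x_1 u + x_2 u² - ⋯ + (-1)ⁿ x_n uⁿ`, which is `∏ (1 - z_i u)` if
`x = π_n(z)`. -/
noncomputable def genPoly {n : ℕ} (x : Fin n → ℂ) (u : ℂ) : ℂ :=
  1 + ∑ k : Fin n, (-1) ^ ((k : ℕ) + 1) * x k * u ^ ((k : ℕ) + 1)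

theorem genPoly_symMap {n : ℕ} (z : Fin n → ℂ) (u : ℂ) :
    genPoly (symMap n z) u = ∏ i, (1 - z i * u) := by
  have h : ∀ i, 1 - z i * u = 1 + (-u) * z i := fun i => by ring
  simp_rw [h]
  rw [Finset.prod_one_add, Finset.sum_powerset, Finset.card_univ, Fintype.card_fin,
    Finset.sum_range_succ', genPoly, Finset.sum_range, add_comm]
  congr 1
  · refine Finset.sum_congr rfl fun k _ => ?_
    rw [symMap, Finset.mul_sum, Finset.sum_mul]
    refine Finset.sum_congr rfl fun t ht => ?_
    rw [Finset.prod_mul_distrib, Finset.prod_const, (Finset.mem_powersetCard.mp ht).2,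
      neg_pow u]
    ring
  · simp

theorem symMap_last {m : ℕ} (z : Fin (m + 1) → ℂ) :
    symMap (m + 1) z (Fin.last m) = ∏ i, z i := by
  have h : Finset.powersetCard (m + 1) (Finset.univ : Finset (Fin (m + 1))) = {Finset.univ} := by
    have h := Finset.powersetCard_self (Finset.univ : Finset (Fin (m + 1)))
    rwa [Finset.card_univ, Fintype.card_fin] at h
  simp [symMap, h]

theorem symMap_conj {n : ℕ} (z : Fin n → ℂ) :
    symMap n (fun i => starRingEnd ℂ (z i)) = fun k => starRingEnd ℂ (symMap n z k) := by
  funext k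
  simp [symMap, map_sum, map_prod]

theorem symMap_surjective (n : ℕ) : Function.Surjective (symMap n) := by
  intro x
  -- Signs and order are those of Vieta's formulas: the coefficient of `X ^ (n - 1 - k)` must be
  -- `(-1) ^ (k + 1) * x k`.
  let g : Fin n → ℂ := fun i => (-1) ^ (n - (i : ℕ)) * x i.rev
  let p : Polynomial ℂ :=
    Polynomial.X ^ n + ∑ i : Fin n, Polynomial.C (g i) * Polynomial.X ^ (i : ℕ)
  have hdeg := Polynomial.degree_sum_fin_lt g
  have hmonic : p.Monic := Polynomial.monic_X_pow_add hdeg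
  have hnat : p.natDegree = n := by
    rw [Polynomial.natDegree_eq_of_degree_eq_some]
    rw [Polynomial.degree_add_eq_left_of_degree_lt (by rwa [Polynomial.degree_X_pow]),
      Polynomial.degree_X_pow]
  have hsplit : p.Splits := IsAlgClosed.splits p
  have hcard : Multiset.card p.roots = n := by
    rw [← hnat]; exact (Polynomial.splits_iff_card_roots.mp hsplit)
  obtain ⟨z, hz⟩ : ∃ z : Fin n → ℂ, Finset.univ.val.map z = p.roots := by
    have hl : p.roots.toList.length = n := by simp [hcard]
    refine ⟨fun i => p.roots.toList.get (i.cast hl.symm), ?_⟩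
    rw [Fin.univ_val_map]
    conv_rhs => rw [← Multiset.coe_toList p.roots]
    congr 1
    apply List.ext_get
    · simp [hcard]
    · intro k h1 h2
      simp
  refine ⟨z, funext fun k => ?_⟩
  have h1 := Polynomial.coeff_eq_esymm_roots_of_splits hsplit (k := n - 1 - (k : ℕ)) (by omega)
  have hk := k.2
  have h2 : p.coeff (n - 1 - (k : ℕ)) = (-1) ^ ((k : ℕ) + 1) * x k := by
    have h3 : n - 1 - (k : ℕ) = (k.rev : ℕ) := by rw [Fin.val_rev]; omega
    simp only [p, Polynomial.coeff_add, Polynomial.coeff_X_pow, Polynomial.finsetSum_coeff,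
      Polynomial.coeff_C_mul]
    rw [if_neg (by omega), h3]
    simp only [Fin.val_inj, mul_ite, mul_one, mul_zero, Finset.sum_ite_eq, Finset.mem_univ,
      if_true, zero_add, g, Fin.rev_rev]
    congr 2
    rw [Fin.val_rev]; omega
  rw [h2, hnat, hmonic.leadingCoeff, one_mul, show n - (n - 1 - (k : ℕ)) = (k : ℕ) + 1 by omega,
    ← hz, Finset.esymm_map_val] at h1
  exact (mul_left_cancel₀ (pow_ne_zero _ (by norm_num)) h1).symm

theorem exists_genPoly_eq_zero {n : ℕ} {z : Fin n → ℂ} {i : Fin n} (hi : z i ≠ 0) :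
    genPoly (symMap n z) (z i)⁻¹ = 0 := by
  rw [genPoly_symMap]
  exact Finset.prod_eq_zero (Finset.mem_univ i) (by rw [mul_inv_cancel₀ hi, sub_self])

/-- The zeros of `∏ (1 - z_i u)` are the reciprocals of the nonzero `z_i`, and every point of `ℂⁿ`
is some `π_n(z)`. -/
theorem mem_closedSym_iff {n : ℕ} (x : Fin n → ℂ) :
    x ∈ closedSym n ↔ ∀ u : ℂ, ‖u‖ < 1 → genPoly x u ≠ 0 := by
  constructor
  · rintro ⟨z, hz, rfl⟩ u hu
    rw [genPoly_symMap, Finset.prod_ne_zero_iff]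
    intro i _ h
    have h1 : ‖z i * u‖ = 1 := by rw [← sub_eq_zero.mp h, norm_one]
    rw [norm_mul] at h1
    nlinarith [hz i, norm_nonneg u, norm_nonneg (z i)]
  · intro h
    obtain ⟨z, rfl⟩ := symMap_surjective n x
    refine ⟨z, fun i => ?_, rfl⟩
    by_contra! hi
    have hi0 : z i ≠ 0 := by intro h0; rw [h0, norm_zero] at hi; linarith
    exact h (z i)⁻¹ (by rw [norm_inv]; exact inv_lt_one_of_one_lt₀ hi) (exists_genPoly_eq_zero hi0)

theorem mem_openSym_iff {n : ℕ} (x : Fin n → ℂ) :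
    x ∈ openSym n ↔ ∀ u : ℂ, ‖u‖ ≤ 1 → genPoly x u ≠ 0 := by
  constructor
  · rintro ⟨z, hz, rfl⟩ u hu
    rw [genPoly_symMap, Finset.prod_ne_zero_iff]
    intro i _ h
    have h1 : ‖z i * u‖ = 1 := by rw [← sub_eq_zero.mp h, norm_one]
    rw [norm_mul] at h1
    have := hz i
    nlinarith [norm_nonneg u, norm_nonneg (z i)]
  · intro h
    obtain ⟨z, rfl⟩ := symMap_surjective n x
    refine ⟨z, fun i => ?_, rfl⟩
    by_contra! hi
    have hi0 : z i ≠ 0 := by intro h0; rw [h0, norm_zero] at hi; linarith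
    exact h (z i)⁻¹ (by rw [norm_inv]; exact inv_le_one_of_one_le₀ hi) (exists_genPoly_eq_zero hi0)

theorem continuous_genPoly {n : ℕ} :
    Continuous fun q : (Fin n → ℂ) × ℂ => genPoly q.1 q.2 := by
  unfold genPoly
  fun_prop

/-- Being zero-free on the compact closed disc is an open condition on the coefficients. -/
theorem isOpen_openSym (n : ℕ) : IsOpen (openSym n) := by
  rw [isOpen_iff_eventually]
  intro x hx
  have h := (isCompact_closedBall (0 : ℂ) 1).eventually_forall_of_forall_eventually
    (x₀ := x) (P := fun y u => genPoly y u ≠ 0) (fun u hu => by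
      have h0 := (mem_openSym_iff x).mp hx u (by simpa using hu)
      exact continuous_genPoly.continuousAt.eventually_ne h0)
  filter_upwards [h] with y hy
  exact (mem_openSym_iff y).mpr fun u hu => hy u (by simpa using hu)

theorem openSym_subset_closedSym (n : ℕ) : openSym n ⊆ closedSym n :=
  Set.image_mono fun _ hz i => (hz i).le

theorem continuous_symMap (n : ℕ) : Continuous (symMap n) := by
  unfold symMap
  fun_prop

theorem differentiable_symMap (n : ℕ) : Differentiable ℂ (symMap n) := by
  unfold symMap
  fun_prop

theorem isCompact_polydisc (n : ℕ) : IsCompact {z : Fin n → ℂ | ∀ i, ‖z i‖ ≤ 1} := by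
  have h : {z : Fin n → ℂ | ∀ i, ‖z i‖ ≤ 1} = Set.univ.pi fun _ => Metric.closedBall (0 : ℂ) 1 := by
    ext z; simp [Set.mem_pi]
  rw [h]
  exact isCompact_univ_pi fun _ => isCompact_closedBall _ _

theorem isCompact_closedSym (n : ℕ) : IsCompact (closedSym n) :=
  (isCompact_polydisc n).image (continuous_symMap n)

theorem openSym_conj {n : ℕ} {x : Fin n → ℂ} (hx : x ∈ openSym n) :
    (fun i => starRingEnd ℂ (x i)) ∈ openSym n := by
  obtain ⟨z, hz, rfl⟩ := hx
  exact ⟨fun i => starRingEnd ℂ (z i), fun i => by simpa using hz i, symMap_conj z⟩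

theorem norm_last_lt_one {m : ℕ} {x : Fin (m + 1) → ℂ} (hx : x ∈ openSym (m + 1)) :
    ‖x (Fin.last m)‖ < 1 := by
  obtain ⟨z, hz, rfl⟩ := hx
  rw [symMap_last, norm_prod, Fin.prod_univ_succ]
  calc ‖z 0‖ * ∏ i : Fin m, ‖z i.succ‖ ≤ ‖z 0‖ * 1 :=
        mul_le_mul_of_nonneg_left
          (Finset.prod_le_one (fun i _ => norm_nonneg _) fun i _ => (hz _).le) (norm_nonneg _)
    _ < 1 := by rw [mul_one]; exact hz 0

theorem norm_last_le_one {m : ℕ} {x : Fin (m + 1) → ℂ} (hx : x ∈ closedSym (m + 1)) :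
    ‖x (Fin.last m)‖ ≤ 1 := by
  obtain ⟨z, hz, rfl⟩ := hx
  rw [symMap_last, norm_prod]
  exact Finset.prod_le_one (fun i _ => norm_nonneg _) fun i _ => hz _

/-- The image of the torus under the symmetrization map. -/
def torusSym (n : ℕ) : Set (Fin n → ℂ) := symMap n '' {z | ∀ i, ‖z i‖ = 1}

theorem torusSym_subset (n : ℕ) : torusSym n ⊆ closedSym n :=
  Set.image_mono fun _ hz i => (hz i).le

theorem isClosed_torusSym (n : ℕ) : IsClosed (torusSym n) := by
  have hcl : IsClosed {z : Fin n → ℂ | ∀ i, ‖z i‖ = 1} := by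
    have h : {z : Fin n → ℂ | ∀ i, ‖z i‖ = 1} = ⋂ i, {z | ‖z i‖ = 1} := by ext z; simp
    rw [h]
    exact isClosed_iInter fun i => isClosed_eq (by fun_prop) continuous_const
  exact (((isCompact_polydisc n).of_isClosed_subset hcl fun z hz i => (hz i).le).image
    (continuous_symMap n)).isClosed

theorem torusSym_conj {n : ℕ} {x : Fin n → ℂ} (hx : x ∈ torusSym n) :
    (fun i => starRingEnd ℂ (x i)) ∈ torusSym n := by
  obtain ⟨z, hz, rfl⟩ := hx
  exact ⟨fun i => starRingEnd ℂ (z i), fun i => by simpa using hz i, symMap_conj z⟩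

theorem mem_torusSym_of_norm_last {m : ℕ} {x : Fin (m + 1) → ℂ} (hx : x ∈ closedSym (m + 1))
    (hp : ‖x (Fin.last m)‖ = 1) : x ∈ torusSym (m + 1) := by
  obtain ⟨z, hz, rfl⟩ := hx
  refine ⟨z, fun i => ?_, rfl⟩
  rw [symMap_last, norm_prod] at hp
  refine le_antisymm (hz i) ?_
  rw [← hp, ← Finset.mul_prod_erase _ _ (Finset.mem_univ i)]
  exact mul_le_of_le_one_right (norm_nonneg _)
    (Finset.prod_le_one (fun j _ => norm_nonneg _) fun j _ => hz j)

theorem norm_last_of_mem_torusSym {m : ℕ} {x : Fin (m + 1) → ℂ} (hx : x ∈ torusSym (m + 1)) :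
    ‖x (Fin.last m)‖ = 1 := by
  obtain ⟨z, hz, rfl⟩ := hx
  rw [symMap_last, norm_prod]
  exact Finset.prod_eq_one fun i _ => hz i

/-- Dilating by `t > 1` makes the last coordinate larger than `1` in modulus, so points outside `Γ`
accumulate at `x`. -/
theorem torusSym_subset_frontier (m : ℕ) : torusSym (m + 1) ⊆ frontier (closedSym (m + 1)) := by
  intro x hx
  refine ⟨subset_closure (torusSym_subset _ hx), fun hint => ?_⟩
  have hp := norm_last_of_mem_torusSym hx
  have hcont : Filter.Tendsto (fun t : ℝ => ((t : ℂ) • x)) (nhdsWithin 1 (Set.Ioi 1)) (nhds x) := by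
    have h : Continuous fun t : ℝ => ((t : ℂ) • x) := by fun_prop
    have := h.tendsto 1
    simp only [Complex.ofReal_one, one_smul] at this
    exact this.mono_left nhdsWithin_le_nhds
  have h1 : ∀ᶠ t : ℝ in nhdsWithin 1 (Set.Ioi 1), ((t : ℂ) • x) ∈ closedSym (m + 1) :=
    hcont.eventually (mem_interior_iff_mem_nhds.mp hint)
  obtain ⟨t, ht, ht1⟩ := (h1.and self_mem_nhdsWithin).exists
  have := norm_last_le_one ht
  rw [Pi.smul_apply, norm_smul, hp, mul_one, Complex.norm_real, Real.norm_eq_abs] at this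
  have h2 : (1 : ℝ) < t := ht1
  linarith [le_abs_self t]

/-! ### Self-inversive polynomials and Cohn's theorem. -/

theorem genPoly_snoc {m : ℕ} (s : Fin m → ℂ) (p u : ℂ) :
    genPoly (Fin.snoc s p : Fin (m + 1) → ℂ) u =
      1 + ∑ k : Fin m, (-1) ^ ((k : ℕ) + 1) * s k * u ^ ((k : ℕ) + 1) +
        (-1) ^ (m + 1) * p * u ^ (m + 1) := by
  simp [genPoly, Fin.sum_univ_castSucc, add_assoc]

theorem norm_sub_le_norm_one_sub {y u : ℂ} (hy : ‖y‖ ≤ 1) (hu : ‖u‖ ≤ 1) :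
    ‖u - starRingEnd ℂ y‖ ≤ ‖1 - y * u‖ := by
  rw [← sq_le_sq₀ (norm_nonneg _) (norm_nonneg _), ← Complex.normSq_eq_norm_sq,
    ← Complex.normSq_eq_norm_sq]
  have h1 : Complex.normSq y ≤ 1 := by
    rw [Complex.normSq_eq_norm_sq]; nlinarith [norm_nonneg y]
  have h2 : Complex.normSq u ≤ 1 := by
    rw [Complex.normSq_eq_norm_sq]; nlinarith [norm_nonneg u]
  have h3 : Complex.normSq (1 - y * u) - Complex.normSq (u - starRingEnd ℂ y) =
      (1 - Complex.normSq y) * (1 - Complex.normSq u) := by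
    simp [Complex.normSq_apply]; ring
  nlinarith [mul_nonneg (sub_nonneg.mpr h1) (sub_nonneg.mpr h2)]

theorem genPoly_conj_reverse {m : ℕ} (y : Fin m → ℂ) (u : ℂ) :
    ∏ i, (u - starRingEnd ℂ (y i)) = u ^ m + ∑ k : Fin m,
      (-1) ^ ((k : ℕ) + 1) * starRingEnd ℂ (symMap m y k) * u ^ (m - 1 - (k : ℕ)) := by
  -- The reversal substitutes `u⁻¹`, so `u = 0` is checked by hand.
  rcases eq_or_ne u 0 with rfl | hu
  · rcases m with _ | m
    · simp
    · have h0 : ∀ k : Fin m, m + 1 - 1 - (k.castSucc : ℕ) ≠ 0 := fun k => by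
        have := k.2; simp; omega
      rw [Fin.sum_univ_castSucc, Finset.sum_eq_zero fun k _ => by rw [zero_pow (h0 k), mul_zero]]
      simp [symMap_last, Finset.prod_neg]
  · have h := genPoly_symMap (fun i => starRingEnd ℂ (y i)) u⁻¹
    have h1 : ∏ i, (u - starRingEnd ℂ (y i)) = u ^ m * ∏ i, (1 - starRingEnd ℂ (y i) * u⁻¹) := by
      have hc : u ^ m = ∏ _i : Fin m, u := by simp
      rw [hc, ← Finset.prod_mul_distrib]
      refine Finset.prod_congr rfl fun i _ => ?_
      field_simp
    rw [h1, ← h, symMap_conj, genPoly, mul_add, mul_one, Finset.mul_sum]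
    congr 1
    refine Finset.sum_congr rfl fun k _ => ?_
    have hk := k.2
    have h2 : u ^ m = u ^ (m - 1 - (k : ℕ)) * u ^ ((k : ℕ) + 1) := by
      rw [← pow_add]; congr 1; omega
    rw [h2, inv_pow]
    field_simp

/-- Cohn's theorem: a self-inversive polynomial whose derivative has all its roots in the closed
disc has all its roots on the circle. -/
theorem snoc_mem_torusSym {m : ℕ} {s : Fin m → ℂ} {p : ℂ} (hp : ‖p‖ = 1)
    (hs : ∀ i, s i = p * starRingEnd ℂ (s i.rev))
    (hd : (fun i : Fin m => (((m : ℂ) - (i : ℕ)) / ((m : ℂ) + 1)) * s i) ∈ closedSym m) :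
    (Fin.snoc s p : Fin (m + 1) → ℂ) ∈ torusSym (m + 1) := by
  refine mem_torusSym_of_norm_last ?_ (by simpa using hp)
  rw [mem_closedSym_iff]
  obtain ⟨y, hy, hys⟩ := hd
  intro u hu hzero
  have hm : (m : ℂ) + 1 ≠ 0 := by exact_mod_cast Nat.succ_ne_zero m
  -- Write `q` for the polynomial of `(s, p)` and `n = m + 1`. The sum here is `u q' / n` without
  -- its top term; self-inversiveness identifies it with the reversal of `q - u q' / n = ∏ (1 - y_i
  -- u)`.
  have hrev : ∑ k : Fin m, (-1) ^ ((k : ℕ) + 1) * (((k : ℕ) + 1 : ℂ) / ((m : ℂ) + 1) * s k) *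
      u ^ ((k : ℕ) + 1) = (-1) ^ (m + 1) * p * u * ∑ k : Fin m,
      (-1) ^ ((k : ℕ) + 1) * starRingEnd ℂ (symMap m y k) * u ^ (m - 1 - (k : ℕ)) := by
    rw [Finset.mul_sum, ← Equiv.sum_comp Fin.revPerm]
    refine Finset.sum_congr rfl fun k _ => ?_
    have hk := k.2
    have h1 : ((k.rev : ℕ) : ℂ) + 1 = m - (k : ℕ) := by
      have : (k.rev : ℕ) + 1 + k = m := by rw [Fin.val_rev]; omega
      have h := congrArg (Nat.cast : ℕ → ℂ) this
      push_cast at h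
      linear_combination h
    rw [Fin.revPerm_apply, h1, hs k.rev, Fin.rev_rev, hys]
    have h2 : (k.rev : ℕ) + 1 = m - k := by rw [Fin.val_rev]; omega
    have h3 : u ^ (m - (k : ℕ)) = u * u ^ (m - 1 - (k : ℕ)) := by
      rw [← pow_succ']; congr 1; omega
    have h4 : (-1 : ℂ) ^ (m - (k : ℕ)) = (-1) ^ (m + 1) * (-1) ^ ((k : ℕ) + 1) := by
      rw [← pow_add, show m + 1 + ((k : ℕ) + 1) = (m - k) + 2 * (k + 1) by omega, pow_add,
        pow_mul]
      simp
    rw [h2, h3, h4]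
    simp only [map_mul, map_div₀, map_sub, map_add, map_natCast, map_one]
    ring
  have hsplit : genPoly (Fin.snoc s p : Fin (m + 1) → ℂ) u =
      ∏ i, (1 - y i * u) + (-1) ^ (m + 1) * p * u * ∏ i, (u - starRingEnd ℂ (y i)) := by
    rw [genPoly_snoc, ← genPoly_symMap, genPoly_conj_reverse, mul_add, ← hrev, genPoly, hys]
    have h5 : (-1) ^ (m + 1) * p * u * u ^ m = (-1) ^ (m + 1) * p * u ^ (m + 1) := by ring
    rw [h5]
    have h6 : ∑ k : Fin m, (-1) ^ ((k : ℕ) + 1) * s k * u ^ ((k : ℕ) + 1) =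
        ∑ k : Fin m, (-1) ^ ((k : ℕ) + 1) * ((((m : ℂ) - (k : ℕ)) / ((m : ℂ) + 1)) * s k) *
          u ^ ((k : ℕ) + 1) +
        ∑ k : Fin m, (-1) ^ ((k : ℕ) + 1) * (((k : ℕ) + 1 : ℂ) / ((m : ℂ) + 1) * s k) *
          u ^ ((k : ℕ) + 1) := by
      rw [← Finset.sum_add_distrib]
      refine Finset.sum_congr rfl fun k _ => ?_
      field_simp
      ring
    rw [h6]
    ring
  have hne : ∀ i, 1 - y i * u ≠ 0 := fun i h => by
    have h1 : ‖y i * u‖ = 1 := by rw [← sub_eq_zero.mp h, norm_one]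
    rw [norm_mul] at h1
    have := hy i
    nlinarith [norm_nonneg u, norm_nonneg (y i)]
  have hpos : 0 < ∏ i, ‖1 - y i * u‖ := Finset.prod_pos fun i _ => norm_pos_iff.mpr (hne i)
  -- Factor by factor, the second product in `hsplit` is dominated by the first. The extra factor
  -- `u` of modulus less than `1` makes this strict, so the two terms cannot cancel.
  have hle : ∏ i, ‖u - starRingEnd ℂ (y i)‖ ≤ ∏ i, ‖1 - y i * u‖ :=
    Finset.prod_le_prod (fun i _ => norm_nonneg _) fun i _ =>
      norm_sub_le_norm_one_sub (hy i) hu.le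
  rw [hsplit] at hzero
  have h7 := congrArg norm (eq_neg_of_add_eq_zero_left hzero)
  rw [norm_neg, norm_mul, norm_mul, norm_mul, norm_pow, norm_neg, norm_one, one_pow, one_mul, hp,
    one_mul, norm_prod, norm_prod] at h7
  nlinarith [norm_nonneg u]

/-! ### The distinguished boundary of the closed symmetrized polydisc -/

theorem continuous_eval_mvPolynomial {n : ℕ} (a : MvPolynomial (Fin n) ℂ) :
    Continuous fun x : Fin n → ℂ => MvPolynomial.eval x a :=
  MvPolynomial.continuous_eval a

theorem differentiable_eval_mvPolynomial {n : ℕ} (a : MvPolynomial (Fin n) ℂ) :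
    Differentiable ℂ fun x : Fin n → ℂ => MvPolynomial.eval x a := fun x =>
  (AnalyticOnNhd.eval_mvPolynomial (𝕜 := ℂ) a x (Set.mem_univ x)).differentiableAt

/-- Pull the quotient back to the polydisc, where a maximum point can be moved to the torus one
coordinate at a time by the one-variable maximum principle. -/
theorem isBoundary_torusSym (n : ℕ) : IsBoundary (closedSym n) (torusSym n) := by
  classical
  refine ⟨isClosed_torusSym n, torusSym_subset n, fun a b hb => ?_⟩
  let f : (Fin n → ℂ) → ℂ := fun z =>
    MvPolynomial.eval (symMap n z) a / MvPolynomial.eval (symMap n z) b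
  have hd : ∀ q : MvPolynomial (Fin n) ℂ, Differentiable ℂ fun z : Fin n → ℂ =>
      MvPolynomial.eval (symMap n z) q := fun q =>
    (differentiable_eval_mvPolynomial q).comp (differentiable_symMap n)
  have hfd : ∀ z : Fin n → ℂ, (∀ i, ‖z i‖ ≤ 1) → DifferentiableAt ℂ f z := by
    intro z hz
    have h := ((hd b z).fun_inv (hb _ ⟨z, hz, rfl⟩)).fun_mul (hd a z)
    simpa only [f, div_eq_inv_mul] using h
  have key : ∀ t : Finset (Fin n), ∃ z : Fin n → ℂ, (∀ i, ‖z i‖ ≤ 1) ∧ (∀ i ∈ t, ‖z i‖ = 1) ∧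
      ∀ w : Fin n → ℂ, (∀ i, ‖w i‖ ≤ 1) → ‖f w‖ ≤ ‖f z‖ := by
    intro t
    induction t using Finset.induction_on with
    | empty =>
      obtain ⟨z, hz, hmax⟩ := (isCompact_polydisc n).exists_isMaxOn (f := fun z => ‖f z‖)
        ⟨0, fun i => by simp⟩
        fun z hz => ((hfd z hz).continuousAt.norm).continuousWithinAt
      exact ⟨z, hz, by simp, fun w hw => hmax hw⟩
    | insert i t hi ih =>
      obtain ⟨z, hz, hzt, hmax⟩ := ih
      have hup : ∀ w : ℂ, ‖w‖ ≤ 1 → ∀ j, ‖Function.update z i w j‖ ≤ 1 := fun w hw j => by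
        rcases eq_or_ne j i with rfl | h
        · simpa using hw
        · simpa [Function.update_of_ne h] using hz j
      have hdc : DiffContOnCl ℂ (fun w => f (Function.update z i w)) (Metric.ball (0 : ℂ) 1) := by
        apply DifferentiableOn.diffContOnCl
        rw [closure_ball _ one_ne_zero]
        intro w hw
        apply DifferentiableAt.differentiableWithinAt
        exact (hfd _ (hup w (by simpa using hw))).comp w
          (hasFDerivAt_update (𝕜 := ℂ) z w).differentiableAt
      obtain ⟨w, hw, hwmax⟩ := Complex.exists_mem_frontier_isMaxOn_norm Metric.isBounded_ball
        (Metric.nonempty_ball.mpr one_pos) hdc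
      rw [frontier_ball _ one_ne_zero, mem_sphere_zero_iff_norm] at hw
      refine ⟨Function.update z i w, hup w hw.le, fun j hj => ?_, fun y hy => ?_⟩
      · rcases eq_or_ne j i with rfl | h
        · simpa using hw
        · rw [Function.update_of_ne h]
          exact hzt j (Finset.mem_of_mem_insert_of_ne hj h)
      · refine (hmax y hy).trans ?_
        have h := hwmax (a := z i)
          (by rw [closure_ball _ one_ne_zero]; simpa using hz i)
        simpa using h
  obtain ⟨z, hz, hz1, hmax⟩ := key Finset.univ
  refine ⟨symMap n z, ⟨z, fun i => hz1 i (Finset.mem_univ i), rfl⟩, ?_⟩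
  rintro _ ⟨w, hw, rfl⟩
  exact hmax w hw

theorem norm_half_one_add_lt {w : ℂ} (hw : ‖w‖ ≤ 1) (hne : w ≠ 1) : ‖(1 / 2 : ℂ) * (1 + w)‖ < 1 := by
  have h1 : w.re ≤ 1 := (Complex.re_le_norm w).trans hw
  have h2 : w.re * w.re + w.im * w.im ≤ 1 := by
    rw [← Complex.normSq_apply, Complex.normSq_eq_norm_sq]; nlinarith [norm_nonneg w]
  have h3 : w.re ≠ 1 := fun h => hne (by
    apply Complex.ext
    · simpa using h
    · have : w.im * w.im ≤ 0 := by nlinarith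
      simpa using mul_self_eq_zero.mp (le_antisymm this (mul_self_nonneg _)))
  have h4 : w.re < 1 := lt_of_le_of_ne h1 h3
  have h5 : ‖1 + w‖ ^ 2 < 2 ^ 2 := by
    rw [← Complex.normSq_eq_norm_sq, Complex.normSq_apply]
    simp only [Complex.add_re, Complex.one_re, Complex.add_im, Complex.one_im]
    nlinarith
  have h6 := lt_of_pow_lt_pow_left₀ 2 (by norm_num) h5
  rw [norm_mul]
  norm_num
  linarith

/-- The product of the peak functions at the points `t_i`, evaluated at a permutation of `z`. -/
noncomputable def peak {n : ℕ} (t : Fin n → ℂ) (σ : Equiv.Perm (Fin n)) (z : Fin n → ℂ) : ℂ :=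
  ∏ i, ((1 / 2 : ℂ) * (1 + starRingEnd ℂ (t i) * z (σ i)))

theorem conj_mul_eq_one_iff {t z : ℂ} (ht : ‖t‖ = 1) : starRingEnd ℂ t * z = 1 ↔ z = t := by
  have h : starRingEnd ℂ t * t = 1 := by
    rw [mul_comm, Complex.mul_conj, Complex.normSq_eq_norm_sq, ht]; simp
  constructor
  · intro h1
    have h2 : t * (starRingEnd ℂ t * z) = t := by rw [h1, mul_one]
    rwa [← mul_assoc, mul_comm t, h, one_mul] at h2
  · rintro rfl; exact h

theorem peak_eq_one {n : ℕ} {t z : Fin n → ℂ} (ht : ∀ i, ‖t i‖ = 1) (σ : Equiv.Perm (Fin n))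
    (h : ∀ i, z (σ i) = t i) : peak t σ z = 1 :=
  Finset.prod_eq_one fun i _ => by rw [(conj_mul_eq_one_iff (ht i)).mpr (h i)]; norm_num

theorem norm_peak_lt_one {n : ℕ} {t z : Fin n → ℂ} (ht : ∀ i, ‖t i‖ = 1) (hz : ∀ i, ‖z i‖ ≤ 1)
    (σ : Equiv.Perm (Fin n)) (h : ∃ i, z (σ i) ≠ t i) : ‖peak t σ z‖ < 1 := by
  obtain ⟨i, hi⟩ := h
  have hle : ∀ j, ‖starRingEnd ℂ (t j) * z (σ j)‖ ≤ 1 := fun j => by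
    rw [norm_mul, RCLike.norm_conj, ht j, one_mul]; exact hz _
  have hf : ∀ j, ‖(1 / 2 : ℂ) * (1 + starRingEnd ℂ (t j) * z (σ j))‖ ≤ 1 := fun j => by
    by_cases hj : starRingEnd ℂ (t j) * z (σ j) = 1
    · rw [hj]; norm_num
    · exact (norm_half_one_add_lt (hle j) hj).le
  rw [peak, norm_prod, ← Finset.mul_prod_erase _ _ (Finset.mem_univ i)]
  refine lt_of_le_of_lt (mul_le_of_le_one_right (norm_nonneg _)
    (Finset.prod_le_one (fun j _ => norm_nonneg _) fun j _ => hf j)) ?_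
  exact norm_half_one_add_lt (hle i) fun h => hi ((conj_mul_eq_one_iff (ht i)).mp h)

/-- The symmetrized powers of `peak` are polynomials on the symmetrized polydisc. -/
theorem exists_eval_symMap_eq_sum_peak {n : ℕ} (t : Fin n → ℂ) (N : ℕ) :
    ∃ a : MvPolynomial (Fin n) ℂ, ∀ z,
      MvPolynomial.eval (symMap n z) a = ∑ σ : Equiv.Perm (Fin n), peak t σ z ^ N := by
  let q : MvPolynomial (Fin n) ℂ := ∑ σ : Equiv.Perm (Fin n),
    (∏ i, (MvPolynomial.C (1 / 2 : ℂ) *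
      (1 + MvPolynomial.C (starRingEnd ℂ (t i)) * MvPolynomial.X (σ i)))) ^ N
  have hq : q.IsSymmetric := by
    intro e
    simp only [q, map_sum, map_pow, map_prod, map_mul, map_add, map_one, MvPolynomial.rename_C,
      MvPolynomial.rename_X]
    exact Equiv.sum_comp (Equiv.mulLeft e) fun σ : Equiv.Perm (Fin n) =>
      (∏ i, (MvPolynomial.C (1 / 2 : ℂ) *
        (1 + MvPolynomial.C (starRingEnd ℂ (t i)) * MvPolynomial.X (σ i)))) ^ N
  obtain ⟨a, ha⟩ := MvPolynomial.esymmAlgHom_surjective (σ := Fin n) ℂ (n := n) (by simp) ⟨q, hq⟩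
  refine ⟨a, fun z => ?_⟩
  have h1 : MvPolynomial.aeval (fun i : Fin n => MvPolynomial.esymm (Fin n) ℂ (i + 1)) a = q := by
    rw [← MvPolynomial.esymmAlgHom_apply, ha]
  have h2 : MvPolynomial.eval z q = ∑ σ : Equiv.Perm (Fin n), peak t σ z ^ N := by
    simp [q, peak, map_sum, map_prod]
  have h3 : ∀ i : Fin n, MvPolynomial.eval z (MvPolynomial.esymm (Fin n) ℂ (i + 1)) =
      symMap n z i := fun i => by
    simp [MvPolynomial.esymm, symMap, map_sum, map_prod]
  rw [← h2, ← h1, MvPolynomial.aeval_def, ← MvPolynomial.coe_eval₂Hom,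
    ← RingHom.comp_apply]
  refine (congrArg (fun φ : MvPolynomial (Fin n) ℂ →+* ℂ => φ a) ?_)
  apply MvPolynomial.ringHom_ext
  · intro c; simp
  · intro i; simp [h3]

/-- If `δ` misses `π_n(t)`, the symmetrized sum of `N`-th powers of peak functions tends to `0`
uniformly on `δ`. At `t` it tends to the number of permutations fixing `t`, which is at least `1`.
For large `N` its maximum is not attained on `δ`. -/
theorem torusSym_subset_of_isBoundary {n : ℕ} {δ : Set (Fin n → ℂ)}
    (hδ : IsBoundary (closedSym n) δ) : torusSym n ⊆ δ := by
  classical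
  rintro _ ⟨t, ht, rfl⟩
  obtain ⟨hcl, hsub, hpeak⟩ := hδ
  by_contra hnot
  let K : Set (Fin n → ℂ) := {z | ∀ i, ‖z i‖ ≤ 1} ∩ symMap n ⁻¹' δ
  have hK : IsCompact K :=
    (isCompact_polydisc n).inter_right (hcl.preimage (continuous_symMap n))
  -- A permutation of `t` has the same image under `π_n`, which is not in `δ`.
  have hKne : ∀ z ∈ K, ∀ σ : Equiv.Perm (Fin n), ∃ i, z (σ i) ≠ t i := by
    rintro z ⟨-, hz⟩ σ
    by_contra! h
    apply hnot
    have h1 : symMap n t = symMap n z := by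
      funext k
      have he : ∀ y : Fin n → ℂ, symMap n y k =
          MvPolynomial.eval y (MvPolynomial.esymm (Fin n) ℂ (k + 1)) := fun y => by
        simp [MvPolynomial.esymm, symMap, map_sum, map_prod]
      have ht' : t = z ∘ σ := funext fun i => (h i).symm
      rw [he, he, ht', ← MvPolynomial.eval_rename,
        MvPolynomial.esymm_isSymmetric (Fin n) ℂ (k + 1) σ]
    rw [h1]; exact hz
  have hbound : ∀ σ : Equiv.Perm (Fin n), ∃ ρ : ℝ, 0 ≤ ρ ∧ ρ < 1 ∧
      ∀ z ∈ K, ‖peak t σ z‖ ≤ ρ := by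
    intro σ
    rcases K.eq_empty_or_nonempty with he | hne
    · exact ⟨0, le_rfl, one_pos, by simp [he]⟩
    · have hc : Continuous fun z => ‖peak t σ z‖ := by unfold peak; fun_prop
      obtain ⟨z, hz, hmax⟩ := hK.exists_isMaxOn hne hc.continuousOn
      exact ⟨_, norm_nonneg _, norm_peak_lt_one ht hz.1 σ (hKne z hz σ), fun w hw => hmax hw⟩
  choose ρ hρ0 hρ1 hρ using hbound
  have hlim0 : Filter.Tendsto (fun N : ℕ => ∑ σ : Equiv.Perm (Fin n), ρ σ ^ N) Filter.atTop
      (nhds 0) := by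
    rw [← Finset.sum_const_zero (s := (Finset.univ : Finset (Equiv.Perm (Fin n))))]
    exact tendsto_finsetSum _ fun σ _ => tendsto_pow_atTop_nhds_zero_of_lt_one (hρ0 σ) (hρ1 σ)
  let L : Equiv.Perm (Fin n) → ℂ := fun σ => if ∀ i, t (σ i) = t i then 1 else 0
  have hlimt : Filter.Tendsto (fun N : ℕ => ‖∑ σ : Equiv.Perm (Fin n), peak t σ t ^ N‖)
      Filter.atTop (nhds ‖∑ σ, L σ‖) := by
    refine (tendsto_finsetSum _ fun σ _ => ?_).norm
    by_cases h : ∀ i, t (σ i) = t i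
    · rw [show L σ = 1 from if_pos h]
      refine tendsto_const_nhds.congr fun N => ?_
      rw [peak_eq_one ht σ h, one_pow]
    · simp only [L, if_neg h]
      apply tendsto_pow_atTop_nhds_zero_of_norm_lt_one
      exact norm_peak_lt_one ht (fun i => (ht i).le) σ (by push Not at h; exact h)
  have hL : 1 ≤ ‖∑ σ, L σ‖ := by
    have h1 : ∑ σ, L σ =
        (((Finset.univ.filter fun σ : Equiv.Perm (Fin n) => ∀ i, t (σ i) = t i).card : ℕ) : ℂ) := by
      simp [L, Finset.sum_boole]
    rw [h1, Complex.norm_natCast]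
    have h2 : 0 < (Finset.univ.filter fun σ : Equiv.Perm (Fin n) => ∀ i, t (σ i) = t i).card :=
      Finset.card_pos.mpr ⟨1, by simp⟩
    exact_mod_cast h2
  have e1 := hlimt.eventually (lt_mem_nhds (show (1 / 2 : ℝ) < _ by linarith))
  have e2 := hlim0.eventually (gt_mem_nhds (show (0 : ℝ) < 1 / 2 by norm_num))
  obtain ⟨N, hN1, hN2⟩ := (e1.and e2).exists
  obtain ⟨a, ha⟩ := exists_eval_symMap_eq_sum_peak t N
  obtain ⟨x, hx, hmax⟩ := hpeak a 1 (by simp)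
  obtain ⟨z, hz, rfl⟩ := hsub hx
  have h1 := hmax (symMap n t) ⟨t, fun i => (ht i).le, rfl⟩
  simp only [map_one, div_one, ha] at h1
  have h2 : ‖∑ σ : Equiv.Perm (Fin n), peak t σ z ^ N‖ ≤ ∑ σ, ρ σ ^ N :=
    (norm_sum_le _ _).trans (Finset.sum_le_sum fun σ _ => by
      rw [norm_pow]; exact pow_le_pow_left₀ (norm_nonneg _) (hρ σ z ⟨hz, hx⟩) N)
  linarith

theorem distinguishedBoundary_closedSym (n : ℕ) :
    distinguishedBoundary (closedSym n) = torusSym n :=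
  Set.Subset.antisymm (Set.sInter_subset_of_mem (isBoundary_torusSym n))
    (Set.subset_sInter fun _ hδ => torusSym_subset_of_isBoundary hδ)

/-! ### Polynomials of a tuple on joint eigenvectors -/

section PolyOp

variable {X : Type*} [NormedAddCommGroup X] [NormedSpace ℂ X]

theorem list_prod_ofFn_apply {n : ℕ} (f : Fin n → (X →L[ℂ] X)) (c : Fin n → ℂ) {v : X}
    (h : ∀ i, f i v = c i • v) : (List.ofFn f).prod v = (∏ i, c i) • v := by
  induction n with
  | zero => simp
  | succ n ih =>
    rw [List.ofFn_succ, List.prod_cons, mul_apply_eq_comp,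
      ih (fun i => f i.succ) (fun i => c i.succ) fun i => h i.succ, map_smul, h 0, smul_smul,
      Fin.prod_univ_succ, mul_comm]

theorem polyOp_apply_of_eigenvector {n : ℕ} {T : Fin n → (X →L[ℂ] X)} {s : Fin n → ℂ} {v : X}
    (h : ∀ i, T i v = s i • v) (f : MvPolynomial (Fin n) ℂ) :
    polyOp T f v = MvPolynomial.eval s f • v := by
  have hpow : ∀ (i : Fin n) (k : ℕ), (T i ^ k) v = s i ^ k • v := fun i k => by
    induction k with
    | zero => simp
    | succ k ih => rw [pow_succ, mul_apply_eq_comp, h i, map_smul, ih, smul_smul,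
        pow_succ, mul_comm]
  rw [polyOp, MvPolynomial.eval_eq', Finset.sum_smul, sum_apply]
  refine Finset.sum_congr rfl fun d _ => ?_
  rw [smul_apply, list_prod_ofFn_apply _ (fun i => s i ^ d i)
    fun i => hpow i (d i), smul_smul]

theorem commute_polyOp {n : ℕ} {T : Fin n → (X →L[ℂ] X)} {A : X →L[ℂ] X}
    (h : ∀ i, Commute A (T i)) (f : MvPolynomial (Fin n) ℂ) : Commute A (polyOp T f) := by
  refine Commute.sum_right _ _ _ fun d _ => Commute.smul_right ?_ _
  refine Commute.list_prod_right _ _ fun x hx => ?_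
  obtain ⟨i, rfl⟩ := (List.mem_ofFn' _ _).mp hx
  exact (h i).pow_right _

theorem continuous_polyOp {n : ℕ} {Y : Type*} [TopologicalSpace Y] {T : Y → Fin n → (X →L[ℂ] X)}
    (h : ∀ i, Continuous fun y => T y i) (f : MvPolynomial (Fin n) ℂ) :
    Continuous fun y => polyOp (T y) f := by
  refine continuous_finsetSum _ fun d _ => Continuous.fun_const_smul ?_ _
  simp_rw [List.ofFn_eq_map]
  exact continuous_list_prod _ fun i _ => (h i).pow _

end PolyOp

/-! ### Zero-free polynomials -/

theorem norm_eval_eq_prod_roots (q : Polynomial ℂ) (w : ℂ) :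
    ‖q.eval w‖ = ‖q.leadingCoeff‖ * (q.roots.map fun a => ‖w - a‖).prod := by
  conv_lhs => rw [← Polynomial.C_leadingCoeff_mul_prod_multiset_X_sub_C
    (Polynomial.splits_iff_card_roots.mp (IsAlgClosed.splits q))]
  rw [Polynomial.eval_mul, Polynomial.eval_C, Polynomial.eval_multiset_prod, norm_mul,
    Multiset.map_map]
  congr 1
  change (normHom : ℂ →*₀ ℝ) _ = _
  rw [map_multiset_prod, Multiset.map_map]
  congr 1
  exact Multiset.map_congr rfl fun a _ => by simp [normHom]

theorem pow_natDegree_le_norm_eval {q : Polynomial ℂ} (hq : q.Monic) {d : ℝ} (hd : 0 ≤ d) {x : ℂ}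
    (h : ∀ a ∈ q.roots, d ≤ ‖x - a‖) : d ^ q.natDegree ≤ ‖q.eval x‖ := by
  have key : ∀ M : Multiset ℂ, (∀ a ∈ M, d ≤ ‖x - a‖) →
      d ^ Multiset.card M ≤ (M.map fun a => ‖x - a‖).prod := by
    intro M
    induction M using Multiset.induction_on with
    | empty => simp
    | cons a M ih =>
      intro hM
      simp only [Multiset.map_cons, Multiset.prod_cons, Multiset.card_cons, pow_succ']
      exact mul_le_mul (hM a (Multiset.mem_cons_self a M))
        (ih fun b hb => hM b (Multiset.mem_cons_of_mem hb)) (pow_nonneg hd _) (norm_nonneg _)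
  rw [norm_eval_eq_prod_roots, hq.leadingCoeff, norm_one, one_mul,
    ← Polynomial.splits_iff_card_roots.mp (IsAlgClosed.splits q)]
  exact key _ h

theorem norm_eval_ge_of_roots {q : Polynomial ℂ} {c : ℝ} {x y : ℂ} (hc0 : 0 ≤ c)
    (hroots : ∀ a ∈ q.roots, ‖y - a‖ * c ≤ ‖x - a‖) :
    ‖q.eval y‖ * c ^ q.natDegree ≤ ‖q.eval x‖ := by
  have hcard : Multiset.card q.roots = q.natDegree :=
    Polynomial.splits_iff_card_roots.mp (IsAlgClosed.splits q)
  have key : ∀ M : Multiset ℂ, (∀ a ∈ M, ‖y - a‖ * c ≤ ‖x - a‖) →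
      (M.map fun a => ‖y - a‖).prod * c ^ Multiset.card M ≤ (M.map fun a => ‖x - a‖).prod ∧
        0 ≤ (M.map fun a => ‖y - a‖).prod := by
    intro M
    induction M using Multiset.induction_on with
    | empty => simp
    | cons a M ih =>
      intro hM
      obtain ⟨h1, h2⟩ := ih fun b hb => hM b (Multiset.mem_cons_of_mem hb)
      have h3 := hM a (Multiset.mem_cons_self a M)
      simp only [Multiset.map_cons, Multiset.prod_cons, Multiset.card_cons]
      refine ⟨?_, mul_nonneg (norm_nonneg _) h2⟩
      calc _ = (‖y - a‖ * c) * ((M.map fun a => ‖y - a‖).prod * c ^ Multiset.card M) := by ring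
        _ ≤ _ := mul_le_mul h3 h1 (mul_nonneg h2 (pow_nonneg hc0 _)) (norm_nonneg _)
  rw [norm_eval_eq_prod_roots, norm_eval_eq_prod_roots, ← hcard, mul_assoc]
  exact mul_le_mul_of_nonneg_left (key _ hroots).1 (norm_nonneg _)

/-- All roots satisfy `|a| ≥ 1`, so `|p - a| ≥ |a| - |p| ≥ |a| (1 - |p|)`. The bound depends on `q`
only through `N` and `q(0)`, so it survives limits. -/
theorem norm_eval_ge_of_zero_free {q : Polynomial ℂ} {N : ℕ} (hN : q.natDegree ≤ N)
    (hq : ∀ p : ℂ, ‖p‖ < 1 → q.eval p ≠ 0) {p : ℂ} (hp : ‖p‖ < 1) :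
    ‖q.eval 0‖ * (1 - ‖p‖) ^ N ≤ ‖q.eval p‖ := by
  refine le_trans ?_ (norm_eval_ge_of_roots (q := q) (c := 1 - ‖p‖) (x := p) (y := 0)
    (by linarith) fun a ha => ?_)
  · exact mul_le_mul_of_nonneg_left (pow_le_pow_of_le_one (by linarith)
      (by linarith [norm_nonneg p]) hN) (norm_nonneg _)
  · have ha1 : 1 ≤ ‖a‖ := by
      by_contra! h
      exact hq a h (Polynomial.isRoot_of_mem_roots ha)
    have := norm_sub_norm_le a p
    rw [zero_sub, norm_neg, norm_sub_rev p a]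
    nlinarith [norm_nonneg p]

/-- A two-variable function that is polynomial in the first variable of bounded degree, and without
zeros for `|p| = 1, |u| < 1` and for `p = 0, |u| ≤ 1`, has no zeros for `|p| < 1, |u| ≤ 1`. -/
theorem ne_zero_of_boundary_zero_free {g : ℂ → ℂ → ℂ} {N : ℕ}
    (hcont : Continuous fun q : ℂ × ℂ => g q.1 q.2)
    (hpoly : ∀ u, ∃ q : Polynomial ℂ, q.natDegree ≤ N ∧ ∀ p, q.eval p = g p u)
    (h0 : ∀ p, g p 0 ≠ 0) (hcirc : ∀ p u, ‖p‖ = 1 → ‖u‖ < 1 → g p u ≠ 0)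
    (hcenter : ∀ u, ‖u‖ ≤ 1 → g 0 u ≠ 0) {p u : ℂ} (hp : ‖p‖ < 1) (hu : ‖u‖ ≤ 1) :
    g p u ≠ 0 := by
  -- A quantitative Hurwitz theorem: zero-freeness in `p` at all `t v`, `0 < t < 1`, passes to `v`,
  -- because the lower bound in terms of `g 0 (t v)` does and `g 0 v ≠ 0`.
  have hlim : ∀ v : ℂ, ‖v‖ ≤ 1 →
      (∀ t : ℝ, 0 < t → t < 1 → ∀ p, ‖p‖ < 1 → g p (t * v) ≠ 0) → ∀ p, ‖p‖ < 1 → g p v ≠ 0 := by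
    intro v hv hfree p hp
    have hest : ∀ t : ℝ, 0 < t → t < 1 → ‖g 0 (t * v)‖ * (1 - ‖p‖) ^ N ≤ ‖g p (t * v)‖ := by
      intro t ht0 ht1
      obtain ⟨q, hqN, hq⟩ := hpoly (t * v)
      rw [← hq, ← hq]
      exact norm_eval_ge_of_zero_free hqN
        (fun p' hp' => by rw [hq]; exact hfree t ht0 ht1 p' hp') hp
    have hc : ∀ p' : ℂ, Filter.Tendsto (fun t : ℝ => ‖g p' (t * v)‖) (nhdsWithin 1 (Set.Iio 1))
        (nhds ‖g p' v‖) := fun p' => by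
      have h : Continuous fun t : ℝ => ‖g p' (t * v)‖ :=
        (hcont.comp (by fun_prop : Continuous fun t : ℝ => (p', (t : ℂ) * v))).norm
      have := h.tendsto 1
      simp only [Complex.ofReal_one, one_mul] at this
      exact this.mono_left nhdsWithin_le_nhds
    have hle : ‖g 0 v‖ * (1 - ‖p‖) ^ N ≤ ‖g p v‖ := by
      refine le_of_tendsto_of_tendsto ((hc 0).mul_const _) (hc p) ?_
      have hpos : ∀ᶠ t : ℝ in nhdsWithin 1 (Set.Iio 1), 0 < t :=
        nhdsWithin_le_nhds (lt_mem_nhds one_pos)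
      filter_upwards [hpos, self_mem_nhdsWithin] with t ht0 ht1
      exact hest t ht0 ht1
    have hgt : 0 < ‖g 0 v‖ * (1 - ‖p‖) ^ N :=
      mul_pos (norm_pos_iff.mpr (hcenter v hv)) (pow_pos (by linarith) _)
    exact norm_pos_iff.mp (hgt.trans_le hle)
  refine hlim u hu ?_ p hp
  by_contra! hex
  obtain ⟨t₁, ht₁0, ht₁1, p₁, hp₁, hz₁⟩ := hex
  -- Take a zero with the least radius `t`. It has `t > 0` by `h0`, it is not over the circle by
  -- `hcirc`, and over the open disc minimality and `hlim` exclude it.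
  let Z : Set (ℝ × ℂ) := (Set.Icc (0 : ℝ) 1 ×ˢ Metric.closedBall (0 : ℂ) 1) ∩
    {q | g q.2 (q.1 * u) = 0}
  have hZ : IsCompact Z := by
    refine (isCompact_Icc.prod (isCompact_closedBall _ _)).inter_right ?_
    exact isClosed_eq (hcont.comp
      (by fun_prop : Continuous fun q : ℝ × ℂ => (q.2, (q.1 : ℂ) * u))) continuous_const
  have hmem : ∀ t : ℝ, ∀ p : ℂ, 0 ≤ t → t ≤ 1 → ‖p‖ ≤ 1 → g p (t * u) = 0 → (t, p) ∈ Z :=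
    fun t p h1 h2 h3 h4 => ⟨⟨⟨h1, h2⟩, by simpa using h3⟩, h4⟩
  obtain ⟨⟨t, p'⟩, ⟨⟨⟨ht0, ht1⟩, hp'⟩, hz⟩, hmin⟩ := hZ.exists_isMinOn
    ⟨_, hmem t₁ p₁ ht₁0.le ht₁1.le hp₁.le hz₁⟩ continuous_fst.continuousOn
  simp only [Set.mem_ofPred_eq] at hz ht0 ht1
  rw [mem_closedBall_zero_iff] at hp'
  simp only at hp'
  have htt₁ : t ≤ t₁ := hmin (hmem t₁ p₁ ht₁0.le ht₁1.le hp₁.le hz₁)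
  have htpos : 0 < t := by
    rcases ht0.eq_or_lt with h | h
    · rw [← h] at hz
      simp only [Complex.ofReal_zero, zero_mul] at hz
      exact absurd hz (h0 p')
    · exact h
  have htu : ‖(t : ℂ) * u‖ < 1 := by
    rw [norm_mul, Complex.norm_real, Real.norm_eq_abs, abs_of_pos htpos]
    nlinarith [norm_nonneg u]
  rcases hp'.lt_or_eq with hlt | heq
  · refine hlim (t * u) htu.le (fun r hr0 hr1 p'' hp'' hzero => ?_) p' hlt hz
    have hrt : r * t < t := by nlinarith
    have := hmin (hmem (r * t) p'' (by positivity) (by linarith) hp''.le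
      (by push_cast; rwa [mul_assoc]))
    have h2 : t ≤ r * t := this
    linarith
  · exact hcirc p' _ heq htu hz

/-! ### Pencils of commuting operators -/

section Pencil

variable {E : Type*} [NormedAddCommGroup E] [NormedSpace ℂ E] {m : ℕ}

/-- The affine pencil `p ↦ A + p B` of operator tuples. -/
def pencil (A B : Fin m → (E →L[ℂ] E)) (p : ℂ) (i : Fin m) : E →L[ℂ] E := A i + p • B i

/-- The operator `1 - u T_1 + u² T_2 - ⋯ + (-1)^{m+1} p u^{m+1}`, where `T = A + p B`. -/
def genOp (A B : Fin m → (E →L[ℂ] E)) (p u : ℂ) : E →L[ℂ] E :=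
  1 + ∑ k : Fin m, ((-1) ^ ((k : ℕ) + 1) * u ^ ((k : ℕ) + 1)) • pencil A B p k +
    ((-1) ^ (m + 1) * p * u ^ (m + 1)) • 1

theorem pencil_zero (A B : Fin m → (E →L[ℂ] E)) : pencil A B 0 = A := by
  funext i; simp [pencil]

theorem genOp_apply {A B : Fin m → (E →L[ℂ] E)} {p u : ℂ} {s : Fin m → ℂ} {v : E}
    (hv : ∀ i, pencil A B p i v = s i • v) :
    genOp A B p u v = genPoly (Fin.snoc s p : Fin (m + 1) → ℂ) u • v := by
  simp only [genOp, genPoly_snoc, add_apply, sum_apply, smul_apply, hv, add_smul, Finset.sum_smul,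
    smul_smul, one_smul, one_apply_eq_self]
  congr 2
  exact Finset.sum_congr rfl fun k _ => by congr 1; ring

theorem commute_genOp {A B : Fin m → (E →L[ℂ] E)} {p : ℂ}
    (hc : ∀ i j, Commute (pencil A B p i) (pencil A B p j)) (u : ℂ) (i : Fin m) :
    Commute (pencil A B p i) (genOp A B p u) :=
  ((Commute.one_right _).add_right (Commute.sum_right _ _ _ fun j _ => (hc i j).smul_right _)).add_right
    ((Commute.one_right _).smul_right _)

theorem continuous_pencil (A B : Fin m → (E →L[ℂ] E)) (i : Fin m) :
    Continuous fun p => pencil A B p i := by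
  unfold pencil; fun_prop

theorem continuous_genOp (A B : Fin m → (E →L[ℂ] E)) :
    Continuous fun q : ℂ × ℂ => genOp A B q.1 q.2 := by
  unfold genOp pencil; fun_prop

/-- Joint eigenvectors in an eigenspace of an operator commuting with the tuple. -/
theorem exists_jointEigenvector_of_commute [FiniteDimensional ℂ E] {T : Fin m → (E →L[ℂ] E)}
    (hT : ∀ i j, Commute (T i) (T j)) {L : E →L[ℂ] E} (hL : ∀ i, Commute (T i) L) {c : ℂ} {w : E}
    (hw0 : w ≠ 0) (hw : L w = c • w) :
    ∃ v : E, v ≠ 0 ∧ L v = c • v ∧ ∃ s : Fin m → ℂ, ∀ i, T i v = s i • v := by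
  have hmul : ∀ {A B : E →L[ℂ] E}, Commute A B → ∀ x, A (B x) = B (A x) := fun h x =>
    DFunLike.congr_fun h.eq x
  obtain ⟨v, hv, hv0, s, hs⟩ := exists_jointEigenvector_mem (fun i => (T i : Module.End ℂ E))
    (fun i j => LinearMap.ext fun x => hmul (hT i j) x)
    (Module.End.eigenspace (L : Module.End ℂ E) c)
    (fun h => hw0 (by
      have hm : w ∈ Module.End.eigenspace (L : Module.End ℂ E) c :=
        Module.End.mem_eigenspace_iff.mpr hw
      rwa [h, Submodule.mem_bot] at hm))
    (fun i x hx => by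
      rw [Module.End.mem_eigenspace_iff] at hx ⊢
      change L (T i x) = c • T i x
      have hx' : L x = c • x := hx
      rw [← hmul (hL i), hx', map_smul])
  exact ⟨v, hv0, Module.End.mem_eigenspace_iff.mp hv, s, hs⟩

theorem det_ne_zero_iff [FiniteDimensional ℂ E] (L : E →L[ℂ] E) :
    L.det ≠ 0 ↔ ∀ v, L v = 0 → v = 0 := by
  have h : L.det = LinearMap.det (L : E →ₗ[ℂ] E) := rfl
  rw [h, Ne, LinearMap.det_eq_zero_iff_ker_ne_bot, not_not, LinearMap.ker_eq_bot']
  rfl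

/-- The degree bound is independent of the coefficients `C₀`, `C₁`, hence of `u` in the application
to `genOp`. -/
theorem exists_polynomial_det [FiniteDimensional ℂ E] (C₀ C₁ : E →L[ℂ] E) :
    ∃ q : Polynomial ℂ, q.natDegree ≤ Module.finrank ℂ E ∧
      ∀ p, q.eval p = (C₀ + p • C₁).det := by
  let b := Module.finBasis ℂ E
  let M₀ := LinearMap.toMatrix b b (C₀ : E →ₗ[ℂ] E)
  let M₁ := LinearMap.toMatrix b b (C₁ : E →ₗ[ℂ] E)
  refine ⟨((Polynomial.X : Polynomial ℂ) • M₁.map Polynomial.C + M₀.map Polynomial.C).det,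
    by simpa using Polynomial.natDegree_det_X_add_C_le M₁ M₀, fun p => ?_⟩
  have h : (C₀ + p • C₁).det = (M₀ + p • M₁).det := by
    change LinearMap.det ((C₀ : E →ₗ[ℂ] E) + p • (C₁ : E →ₗ[ℂ] E)) = _
    rw [← LinearMap.det_toMatrix b, map_add, map_smul]
  rw [h, ← Polynomial.coe_evalRingHom, RingHom.map_det]
  congr 1
  ext i j
  simp only [RingHom.mapMatrix_apply, Matrix.map_apply, Matrix.add_apply, Matrix.smul_apply,
    Polynomial.coe_evalRingHom, smul_eq_mul, Polynomial.eval_add, Polynomial.eval_mul,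
    Polynomial.eval_X, Polynomial.eval_C]
  ring

theorem genOp_eq_add_smul (A B : Fin m → (E →L[ℂ] E)) (u : ℂ) :
    ∃ C₀ C₁ : E →L[ℂ] E, ∀ p, genOp A B p u = C₀ + p • C₁ := by
  refine ⟨1 + ∑ k : Fin m, ((-1) ^ ((k : ℕ) + 1) * u ^ ((k : ℕ) + 1)) • A k,
    ∑ k : Fin m, ((-1) ^ ((k : ℕ) + 1) * u ^ ((k : ℕ) + 1)) • B k +
      ((-1) ^ (m + 1) * u ^ (m + 1)) • 1, fun p => ?_⟩
  simp only [genOp, pencil, smul_add, Finset.sum_add_distrib, Finset.smul_sum]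
  have h : ∀ k : Fin m, ((-1 : ℂ) ^ ((k : ℕ) + 1) * u ^ ((k : ℕ) + 1)) • p • B k =
      p • ((-1 : ℂ) ^ ((k : ℕ) + 1) * u ^ ((k : ℕ) + 1)) • B k := fun k => smul_comm _ _ _
  simp only [h]
  module

/-- The points of `𝔾_{m+1}` over the joint eigenvalues of a pencil. -/
def pencilVariety (A B : Fin m → (E →L[ℂ] E)) : Set (Fin (m + 1) → ℂ) :=
  {x | x ∈ openSym (m + 1) ∧
    IsJointEigenvalue (fun i => (pencil A B (x (Fin.last m)) i : Module.End ℂ E))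
      fun i => x i.castSucc}

theorem isCompact_closure_pencilVariety (A B : Fin m → (E →L[ℂ] E)) :
    IsCompact (closure (pencilVariety A B)) :=
  (isCompact_closedSym (m + 1)).of_isClosed_subset isClosed_closure
    (closure_minimal (fun _ hy => openSym_subset_closedSym _ hy.1)
      (isCompact_closedSym (m + 1)).isClosed)

/-- The joint eigenvalues of the pencil `A + p B` form a distinguished variety. The hypotheses:
commutativity over the closed disc, position of the joint eigenvalues over the circle and over
the centre. -/
structure IsDistinguishedPencil (A B : Fin m → (E →L[ℂ] E)) : Prop where
  comm : ∀ p : ℂ, ‖p‖ ≤ 1 → ∀ i j, Commute (pencil A B p i) (pencil A B p j)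
  circle : ∀ p : ℂ, ‖p‖ = 1 → ∀ s : Fin m → ℂ,
    IsJointEigenvalue (fun i => (pencil A B p i : Module.End ℂ E)) s →
      (Fin.snoc s p : Fin (m + 1) → ℂ) ∈ torusSym (m + 1)
  center : ∀ s : Fin m → ℂ, IsJointEigenvalue (fun i => (A i : Module.End ℂ E)) s → s ∈ openSym m

variable [FiniteDimensional ℂ E] {A B : Fin m → (E →L[ℂ] E)}

/-- The kernel of `genOp` is invariant under the commuting tuple, so if nonzero it contains a joint
eigenvector, on which `genOp` acts as the scalar `genPoly`. -/
theorem det_genOp_ne_zero {p : ℂ} (hc : ∀ i j, Commute (pencil A B p i) (pencil A B p j)) {u : ℂ}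
    (h : ∀ s : Fin m → ℂ, IsJointEigenvalue (fun i => (pencil A B p i : Module.End ℂ E)) s →
      genPoly (Fin.snoc s p : Fin (m + 1) → ℂ) u ≠ 0) : (genOp A B p u).det ≠ 0 := by
  rw [det_ne_zero_iff]
  intro w hw
  by_contra hw0
  obtain ⟨v, hv0, hv, s, hs⟩ := exists_jointEigenvector_of_commute hc
    (fun i => commute_genOp hc u i) hw0 (c := 0) (by rw [hw, zero_smul])
  rw [genOp_apply hs, zero_smul] at hv
  exact h s ⟨v, hv0, hs⟩ ((smul_eq_zero.mp hv).resolve_right hv0)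

/-- Zeros of `genPoly (s, p)` are zeros of `det genOp`. These are absent over the circle for `|u| <
1` and over the centre for `|u| ≤ 1`, hence absent for `|p| < 1`, `|u| ≤ 1`. -/
theorem IsDistinguishedPencil.snoc_mem_openSym (h : IsDistinguishedPencil A B) {p : ℂ}
    (hp : ‖p‖ < 1) {s : Fin m → ℂ}
    (hs : IsJointEigenvalue (fun i => (pencil A B p i : Module.End ℂ E)) s) :
    (Fin.snoc s p : Fin (m + 1) → ℂ) ∈ openSym (m + 1) := by
  rw [mem_openSym_iff]
  intro u hu hzero
  have hne := ne_zero_of_boundary_zero_free (g := fun p u => (genOp A B p u).det)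
    (N := Module.finrank ℂ E)
    (ContinuousLinearMap.continuous_det.comp (continuous_genOp A B))
    (fun u => by
      obtain ⟨C₀, C₁, hC⟩ := genOp_eq_add_smul A B u
      simpa only [hC] using exists_polynomial_det C₀ C₁)
    (fun p => by
      rw [det_ne_zero_iff]
      intro v hv
      simpa [genOp] using hv)
    (fun p u hp hu => det_genOp_ne_zero (h.comm p hp.le) fun s hs =>
      (mem_closedSym_iff _).mp (torusSym_subset _ (h.circle p hp s hs)) u hu)
    (fun u hu => det_genOp_ne_zero (h.comm 0 (by simp)) fun s hs => by
      rw [pencil_zero] at hs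
      have h1 := (mem_openSym_iff _).mp (h.center s hs) u hu
      rw [genPoly_snoc]
      simpa [genPoly] using h1) hp hu
  obtain ⟨v, hv0, hv⟩ := hs
  refine hv0 ((det_ne_zero_iff _).mp hne v ?_)
  rw [genOp_apply hv, hzero, zero_smul]

theorem exists_mvPolynomial_det (A B : Fin m → (E →L[ℂ] E)) (a : Fin m → ℂ) :
    ∃ q : MvPolynomial (Fin (m + 1)) ℂ, ∀ x : Fin (m + 1) → ℂ, MvPolynomial.eval x q =
      LinearMap.det (∑ i, a i •
        ((pencil A B (x (Fin.last m)) i : Module.End ℂ E) - x i.castSucc • 1)) := by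
  let b := Module.finBasis ℂ E
  let MA := fun i => LinearMap.toMatrix b b (A i : E →ₗ[ℂ] E)
  let MB := fun i => LinearMap.toMatrix b b (B i : E →ₗ[ℂ] E)
  let M : Matrix (Fin (Module.finrank ℂ E)) (Fin (Module.finrank ℂ E))
      (MvPolynomial (Fin (m + 1)) ℂ) := Matrix.of fun k l => ∑ i, MvPolynomial.C (a i) *
    (MvPolynomial.C (MA i k l) + MvPolynomial.X (Fin.last m) * MvPolynomial.C (MB i k l) -
      MvPolynomial.X i.castSucc * if k = l then 1 else 0)
  refine ⟨M.det, fun x => ?_⟩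
  rw [RingHom.map_det, ← LinearMap.det_toMatrix b]
  congr 1
  ext k l
  have hone : LinearMap.toMatrix b b (1 : Module.End ℂ E) = 1 := LinearMap.toMatrix_one b
  have hp : ∀ i, LinearMap.toMatrix b b
      (pencil A B (x (Fin.last m)) i : Module.End ℂ E) = MA i + x (Fin.last m) • MB i := fun i => by
    change LinearMap.toMatrix b b ((A i : E →ₗ[ℂ] E) + x (Fin.last m) • (B i : E →ₗ[ℂ] E)) = _
    rw [map_add, map_smul]
  simp only [map_sum, map_smul, map_sub, hone, hp]
  simp only [RingHom.mapMatrix_apply, Matrix.map_apply, M, Matrix.of_apply, map_sum, map_mul,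
    map_sub, map_add, MvPolynomial.eval_C, MvPolynomial.eval_X, Matrix.sum_apply,
    Matrix.smul_apply, Matrix.sub_apply, Matrix.add_apply, Matrix.one_apply, smul_eq_mul]
  refine Finset.sum_congr rfl fun i _ => ?_
  split_ifs <;> simp

theorem isJointEigenvalue_iff_det {T : Fin m → (E →L[ℂ] E)} (hT : ∀ i j, Commute (T i) (T j))
    (s : Fin m → ℂ) : IsJointEigenvalue (fun i => (T i : Module.End ℂ E)) s ↔
      ∀ a : Fin m → ℂ, LinearMap.det (∑ i, a i • ((T i : Module.End ℂ E) - s i • 1)) = 0 := by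
  rw [isJointEigenvalue_iff _ fun i j => LinearMap.ext fun x => DFunLike.congr_fun (hT i j).eq x]
  refine forall_congr' fun a => ?_
  rw [LinearMap.isUnit_iff_isUnit_det, isUnit_iff_ne_zero, not_not]

/-- Joint eigenvalues are cut out by the vanishing of determinants polynomial in `x`, a closed
condition. Commutativity up to `|p| = 1` lets it be read back at limit points. -/
theorem closure_pencilVariety_subset
    (hcomm : ∀ p : ℂ, ‖p‖ ≤ 1 → ∀ i j, Commute (pencil A B p i) (pencil A B p j)) :
    closure (pencilVariety A B) ⊆ {x | x ∈ closedSym (m + 1) ∧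
      IsJointEigenvalue (fun i => (pencil A B (x (Fin.last m)) i : Module.End ℂ E))
        fun i => x i.castSucc} := by
  intro x hx
  have h1 : x ∈ closedSym (m + 1) :=
    closure_minimal (fun y hy => openSym_subset_closedSym _ hy.1)
      (isCompact_closedSym (m + 1)).isClosed hx
  refine ⟨h1, (isJointEigenvalue_iff_det (hcomm _ (norm_last_le_one h1)) _).mpr fun a => ?_⟩
  obtain ⟨q, hq⟩ := exists_mvPolynomial_det A B a
  rw [← hq]
  refine closure_minimal (t := {x | MvPolynomial.eval x q = 0}) (fun y hy => ?_)
    (isClosed_eq (continuous_eval_mvPolynomial q) continuous_const) hx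
  rw [Set.mem_ofPred_eq, hq]
  exact (isJointEigenvalue_iff_det (hcomm _ (norm_last_lt_one hy.1).le) _).mp hy.2 a

theorem snoc_castSucc_last (x : Fin (m + 1) → ℂ) :
    (Fin.snoc (fun i : Fin m => x i.castSucc) (x (Fin.last m)) : Fin (m + 1) → ℂ) = x :=
  Fin.snoc_init_self x

theorem IsDistinguishedPencil.isDistinguishedVariety (h : IsDistinguishedPencil A B) :
    IsDistinguishedVariety (pencilVariety A B) := by
  constructor
  · choose q hq using exists_mvPolynomial_det A B
    refine ⟨Set.range q, ?_⟩
    ext x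
    simp only [pencilVariety, Set.mem_ofPred_eq, Set.forall_mem_range, hq]
    exact and_congr_right fun hx =>
      isJointEigenvalue_iff_det (h.comm _ (norm_last_lt_one hx).le) _
  · rw [distinguishedBoundary_closedSym]
    ext x
    refine and_congr_right fun hx => ⟨fun hfr => ?_, fun ht => torusSym_subset_frontier m ht⟩
    obtain ⟨h1, h2⟩ := closure_pencilVariety_subset h.comm hx
    rcases (norm_last_le_one h1).lt_or_eq with hlt | heq
    · exfalso
      have h3 := h.snoc_mem_openSym hlt h2
      rw [snoc_castSucc_last] at h3
      exact hfr.2 (interior_maximal (openSym_subset_closedSym _) (isOpen_openSym _) h3)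
    · have h3 := h.circle _ heq _ h2
      rwa [snoc_castSucc_last] at h3

theorem IsDistinguishedPencil.pencilVariety_nonempty [Nontrivial E]
    (h : IsDistinguishedPencil A B) : (pencilVariety A B).Nonempty := by
  obtain ⟨w, hw⟩ := exists_ne (0 : E)
  obtain ⟨v, hv0, -, s, hs⟩ := exists_jointEigenvector_of_commute (h.comm 0 (by simp))
    (L := 1) (fun i => Commute.one_right _) hw (c := 1) (by simp)
  exact ⟨Fin.snoc s 0, h.snoc_mem_openSym (by simp) ⟨v, hv0, hs⟩, v, hv0, by simpa using hs⟩

/-- Bounds for polynomials on the variety of a pencil persist over the unit circle. -/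
theorem IsDistinguishedPencil.norm_eval_le (h : IsDistinguishedPencil A B)
    {f : MvPolynomial (Fin (m + 1)) ℂ} {M : ℝ}
    (hM : ∀ x ∈ pencilVariety A B, ‖MvPolynomial.eval x f‖ ≤ M) {p : ℂ} (hp : ‖p‖ = 1)
    {s : Fin m → ℂ} (hs : IsJointEigenvalue (fun i => (pencil A B p i : Module.End ℂ E)) s) :
    ‖MvPolynomial.eval (Fin.snoc s p : Fin (m + 1) → ℂ) f‖ ≤ M := by
  let T : ℂ → Fin (m + 1) → (E →L[ℂ] E) := fun p => Fin.snoc (pencil A B p) (p • 1)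
  let L : ℂ → (E →L[ℂ] E) := fun p => polyOp (T p) f
  have hL : Continuous L := continuous_polyOp (fun i => by
    induction i using Fin.lastCases with
    | last => simp only [T, Fin.snoc_last]; fun_prop
    | cast i => simpa only [T, Fin.snoc_castSucc] using continuous_pencil A B i) f
  have hLv : ∀ {p : ℂ} {s : Fin m → ℂ} {v : E}, (∀ i, pencil A B p i v = s i • v) →
      L p v = MvPolynomial.eval (Fin.snoc s p : Fin (m + 1) → ℂ) f • v := fun {p s v} hv => by
    refine polyOp_apply_of_eigenvector (fun i => ?_) f
    induction i using Fin.lastCases with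
    | last => simp [T]
    | cast i => simpa [T] using hv i
  obtain ⟨v, hv0, hv⟩ := hs
  set c := MvPolynomial.eval (Fin.snoc s p : Fin (m + 1) → ℂ) f
  by_contra! hc
  -- No continuous choice of eigenvalues is needed. Every eigenvalue of `f(T(rp), rp)` is a value of
  -- `f` on the variety, so is at most `M` in modulus. If `|c| > M`, then `det (c - L(rp))` stays
  -- away from `0` as `r → 1`, while `c` is an eigenvalue of `L p`.
  have hdet : ∀ r : ℝ, 0 ≤ r → r < 1 →
      (‖c‖ - M) ^ Module.finrank ℂ E ≤ ‖(c • 1 - L (r * p)).det‖ := by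
    intro r hr0 hr1
    have hrp : ‖(r : ℂ) * p‖ < 1 := by
      rw [norm_mul, hp, mul_one, Complex.norm_real, Real.norm_eq_abs, abs_of_nonneg hr0]
      exact hr1
    set χ := LinearMap.charpoly (L (r * p) : Module.End ℂ E)
    have hroots : ∀ a ∈ χ.roots, ‖a‖ ≤ M := by
      intro a ha
      have hev : Module.End.HasEigenvalue (L (r * p) : Module.End ℂ E) a :=
        Module.End.hasEigenvalue_iff_isRoot_charpoly _ _ |>.mpr (Polynomial.isRoot_of_mem_roots ha)
      obtain ⟨w, hw⟩ := hev.exists_hasEigenvector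
      obtain ⟨v', hv'0, hv', s', hs'⟩ := exists_jointEigenvector_of_commute
        (h.comm _ hrp.le) (L := L (r * p)) (fun i => commute_polyOp (fun j => by
          induction j using Fin.lastCases with
          | last => simpa [T] using (Commute.one_right _).smul_right _
          | cast j => simpa [T] using h.comm _ hrp.le i j) f) hw.2 (c := a) hw.apply_eq_smul
      rw [hLv hs'] at hv'
      have hae := smul_left_injective ℂ hv'0 hv'
      rw [← hae]
      exact hM _ ⟨h.snoc_mem_openSym hrp ⟨v', hv'0, hs'⟩, v', hv'0, by simpa using hs'⟩
    have heval : χ.eval c = (c • 1 - L (r * p)).det := by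
      change χ.eval c = LinearMap.det (c • (1 : Module.End ℂ E) - (L (r * p) : Module.End ℂ E))
      rw [LinearMap.eval_charpoly, Module.algebraMap_end_eq_smul_id]
      rfl
    rw [← heval, ← LinearMap.charpoly_natDegree (L (r * p) : Module.End ℂ E)]
    exact pow_natDegree_le_norm_eval (LinearMap.charpoly_monic _) (by linarith) fun a ha =>
      (sub_le_sub_left (hroots a ha) _).trans (norm_sub_norm_le c a)
  have hlim : Filter.Tendsto (fun r : ℝ => ‖(c • 1 - L (r * p)).det‖) (nhdsWithin 1 (Set.Iio 1))
      (nhds ‖(c • 1 - L p).det‖) := by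
    have h : Continuous fun r : ℝ => ‖(c • 1 - L (r * p)).det‖ :=
      (ContinuousLinearMap.continuous_det.comp
        (continuous_const.sub (hL.comp (by fun_prop)))).norm
    have := h.tendsto 1
    simp only [Complex.ofReal_one, one_mul] at this
    exact this.mono_left nhdsWithin_le_nhds
  have hge : (‖c‖ - M) ^ Module.finrank ℂ E ≤ ‖(c • 1 - L p).det‖ := by
    refine ge_of_tendsto hlim ?_
    have hpos : ∀ᶠ t : ℝ in nhdsWithin 1 (Set.Iio 1), 0 < t :=
      nhdsWithin_le_nhds (lt_mem_nhds one_pos)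
    filter_upwards [hpos, self_mem_nhdsWithin] with t ht0 ht1
    exact hdet t ht0.le ht1
  have hne : (c • 1 - L p).det ≠ 0 :=
    norm_pos_iff.mp ((pow_pos (by linarith) _).trans_le hge)
  exact hv0 ((det_ne_zero_iff _).mp hne v (by simp [hLv hv, c]))

end Pencil

/-! ### From scalar to matrix-valued bounds. -/

section

variable {E : Type*} [NormedAddCommGroup E] [NormedSpace ℂ E] [FiniteDimensional ℂ E]

/-- Bounds for matrix polynomials on the variety of a pencil persist over the unit circle. -/
theorem IsDistinguishedPencil.matPolyNorm_le {m k : ℕ} {A B : Fin m → (E →L[ℂ] E)}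
    (h : IsDistinguishedPencil A B)
    {f : Matrix (Fin k) (Fin k) (MvPolynomial (Fin (m + 1)) ℂ)} {M : ℝ} (hM0 : 0 ≤ M)
    (hM : ∀ x ∈ pencilVariety A B, matPolyNorm f x ≤ M) {p : ℂ} (hp : ‖p‖ = 1)
    {s : Fin m → ℂ} (hs : IsJointEigenvalue (fun i => (pencil A B p i : Module.End ℂ E)) s) :
    matPolyNorm f (Fin.snoc s p) ≤ M := by
  have key : ∀ ξ η : EuclideanSpace ℂ (Fin k), ‖inner ℂ η (Matrix.toEuclideanCLM (n := Fin k)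
      (𝕜 := ℂ) (f.map (MvPolynomial.eval (Fin.snoc s p : Fin (m + 1) → ℂ))) ξ)‖ ≤
        M * ‖ξ‖ * ‖η‖ := by
    intro ξ η
    -- For fixed vectors, `⟨η, f(x) ξ⟩` is a scalar polynomial in `x`, to which the scalar bound
    -- applies.
    let q : MvPolynomial (Fin (m + 1)) ℂ :=
      ∑ i, ∑ j, MvPolynomial.C (starRingEnd ℂ (η i) * ξ j) * f i j
    have hq : ∀ x, MvPolynomial.eval x q = inner ℂ η (Matrix.toEuclideanCLM (n := Fin k)
        (𝕜 := ℂ) (f.map (MvPolynomial.eval x)) ξ) := fun x => by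
      rw [PiLp.inner_apply]
      simp only [q, map_sum, map_mul, MvPolynomial.eval_C]
      refine Finset.sum_congr rfl fun i _ => ?_
      rw [RCLike.inner_apply, Matrix.ofLp_toEuclideanCLM]
      simp only [Matrix.mulVec, dotProduct, Matrix.map_apply, Finset.sum_mul]
      exact Finset.sum_congr rfl fun j _ => by ring
    rw [← hq]
    refine h.norm_eval_le (fun x hx => ?_) hp hs
    rw [hq]
    refine (norm_inner_le_norm _ _).trans ?_
    rw [mul_comm]
    exact mul_le_mul_of_nonneg_right (ContinuousLinearMap.le_of_opNorm_le _ (hM x hx) ξ)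
      (norm_nonneg _)
  refine ContinuousLinearMap.opNorm_le_bound _ hM0 fun ξ => ?_
  set w := Matrix.toEuclideanCLM (n := Fin k) (𝕜 := ℂ)
    (f.map (MvPolynomial.eval (Fin.snoc s p : Fin (m + 1) → ℂ))) ξ
  have h1 := key ξ w
  rw [inner_self_eq_norm_sq_to_K] at h1
  have h2 : ‖w‖ * ‖w‖ ≤ M * ‖ξ‖ * ‖w‖ := by
    rw [← sq]; simpa using h1
  rcases (norm_nonneg w).eq_or_lt with h0 | h0
  · rw [← h0]; positivity
  · exact le_of_mul_le_mul_right h2 h0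

end

/-! ### Commuting normal operators -/

section Normal

variable {E : Type*} [NormedAddCommGroup E] [InnerProductSpace ℂ E] [FiniteDimensional ℂ E]
  [CompleteSpace E]

open ContinuousLinearMap in
/-- Simultaneous diagonalization of commuting normal operators. -/
theorem exists_orthonormalBasis_jointEigenvector {n : ℕ} {T : Fin n → (E →L[ℂ] E)}
    (hT : ∀ i j, Commute (T i) (T j)) (hT' : ∀ i j, Commute (T i) (adjoint (T j))) :
    ∃ (b : OrthonormalBasis (Fin (Module.finrank ℂ E)) ℂ E)
      (s : Fin (Module.finrank ℂ E) → Fin n → ℂ), ∀ k i, T i (b k) = s k i • b k := by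
  classical
  have hT'' : ∀ i j, Commute (adjoint (T i)) (adjoint (T j)) := fun i j => by
    have := congrArg adjoint (hT i j).eq
    rw [mul_def, mul_def, adjoint_comp, adjoint_comp] at this
    exact this.symm
  have hTs : ∀ i j, Commute (adjoint (T i)) (T j) := fun i j => (hT' j i).symm
  -- The operators `T + T^*` and `i (T - T^*)` are self-adjoint and commute, and they recover `T`.
  let R : Fin n ⊕ Fin n → (E →L[ℂ] E) := Sum.elim (fun i => T i + adjoint (T i))
    (fun i => Complex.I • (T i - adjoint (T i)))
  have hRs : ∀ i, IsSelfAdjoint (R i) := by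
    rintro (i | i)
    · simp [R, IsSelfAdjoint, star_eq_adjoint, add_comm]
    · simp [R, IsSelfAdjoint, star_eq_adjoint, ← smul_neg]
  have hRc : ∀ i j, Commute (R i) (R j) := by
    rintro (i | i) (j | j)
    · exact ((hT i j).add_right (hT' i j)).add_left ((hTs i j).add_right (hT'' i j))
    · exact (((hT i j).sub_right (hT' i j)).add_left
        ((hTs i j).sub_right (hT'' i j))).smul_right _
    · exact (((hT i j).add_right (hT' i j)).sub_left
        ((hTs i j).add_right (hT'' i j))).smul_left _
    · exact ((((hT i j).sub_right (hT' i j)).sub_left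
        ((hTs i j).sub_right (hT'' i j))).smul_left _).smul_right _
  let R' : Fin n ⊕ Fin n → Module.End ℂ E := fun i => (R i : E →ₗ[ℂ] E)
  have hsym : ∀ i, (R' i).IsSymmetric := fun i => (hRs i).isSymmetric
  have hcom : Pairwise (Function.onFun Commute R') := fun i j _ =>
    LinearMap.ext fun x => DFunLike.congr_fun (hRc i j).eq x
  let V : (Fin n ⊕ Fin n → ℂ) → Submodule ℂ E := fun χ => ⨅ i, Module.End.eigenspace (R' i) (χ i)
  have hint : DirectSum.IsInternal V :=
    LinearMap.IsSymmetric.directSum_isInternal_of_pairwise_commute hsym hcom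
  have horth : OrthogonalFamily ℂ (fun χ => V χ) fun χ => (V χ).subtypeₗᵢ :=
    LinearMap.IsSymmetric.orthogonalFamily_iInf_eigenspaces hsym
  -- The family `V` is indexed by all of `ℂ^(2n)`; a subordinate basis needs a finite index, so
  -- trivial eigenspaces are discarded.
  have hfin : Finite {χ // V χ ≠ ⊥} :=
    WellFoundedGT.finite_ne_bot_of_iSupIndep hint.submodule_iSupIndep
  have := Fintype.ofFinite {χ // V χ ≠ ⊥}
  have hint' : DirectSum.IsInternal fun χ : {χ // V χ ≠ ⊥} => V χ :=
    DirectSum.isInternal_ne_bot_iff.mpr hint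
  have horth' : OrthogonalFamily ℂ (fun χ : {χ // V χ ≠ ⊥} => V χ) fun χ =>
      (V χ).subtypeₗᵢ := horth.comp Subtype.val_injective
  let b := hint'.subordinateOrthonormalBasis rfl horth'
  let χ := fun k => (hint'.subordinateOrthonormalBasisIndex rfl k horth').1
  have hb : ∀ k i, R i (b k) = χ k i • b k := fun k i => by
    have h := hint'.subordinateOrthonormalBasis_subordinate rfl k horth'
    exact Module.End.mem_eigenspace_iff.mp ((Submodule.mem_iInf _).mp h i)
  refine ⟨b, fun k i => (1 / 2 : ℂ) * (χ k (Sum.inl i) - Complex.I * χ k (Sum.inr i)),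
    fun k i => ?_⟩
  have h : T i = (1 / 2 : ℂ) • (R (Sum.inl i) - Complex.I • R (Sum.inr i)) := by
    simp only [R, Sum.elim_inl, Sum.elim_inr, smul_smul, Complex.I_mul_I]
    module
  rw [h]
  simp only [smul_apply, sub_apply, hb]
  module

theorem blockOp_apply {k : ℕ} {X : Type*} [NormedAddCommGroup X] [NormedSpace ℂ X]
    (A : Matrix (Fin k) (Fin k) (X →L[ℂ] X)) (x : PiLp 2 fun _ : Fin k => X) (i : Fin k) :
    blockOp A x i = ∑ j, A i j (x j) := by
  simp [blockOp]

/-- The matrix-valued von Neumann inequality for commuting normal operators. -/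
theorem norm_matPolyOp_le_of_normal {n k : ℕ} {T : Fin n → (E →L[ℂ] E)}
    (hT : ∀ i j, Commute (T i) (T j))
    (hT' : ∀ i j, Commute (T i) (ContinuousLinearMap.adjoint (T j)))
    (f : Matrix (Fin k) (Fin k) (MvPolynomial (Fin n) ℂ)) {M : ℝ} (hM0 : 0 ≤ M)
    (hM : ∀ s, IsJointEigenvalue (fun i => (T i : Module.End ℂ E)) s → matPolyNorm f s ≤ M) :
    ‖matPolyOp T f‖ ≤ M := by
  obtain ⟨b, s, hb⟩ := exists_orthonormalBasis_jointEigenvector hT hT'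
  refine ContinuousLinearMap.opNorm_le_bound _ hM0 fun c => ?_
  rw [← sq_le_sq₀ (norm_nonneg _) (by positivity), mul_pow, PiLp.norm_sq_eq_of_L2,
    PiLp.norm_sq_eq_of_L2]
  simp_rw [← b.sum_sq_norm_inner_right]
  rw [Finset.sum_comm, Finset.sum_comm (s := (Finset.univ : Finset (Fin k))), Finset.mul_sum]
  refine Finset.sum_le_sum fun l _ => ?_
  -- In the coordinates of `b`, the operator `f(T)` is block diagonal with blocks `f(s l)`.
  have hcoef : ∀ i, inner ℂ (b l) (matPolyOp T f c i) =
      Matrix.toEuclideanCLM (n := Fin k) (𝕜 := ℂ) (f.map (MvPolynomial.eval (s l)))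
        (WithLp.toLp 2 fun j => inner ℂ (b l) (c j)) i := fun i => by
    rw [Matrix.toEuclideanCLM_toLp]
    simp only [Matrix.mulVec, dotProduct, Matrix.map_apply]
    rw [matPolyOp, blockOp_apply, inner_sum]
    refine Finset.sum_congr rfl fun j _ => ?_
    rw [Matrix.map_apply]
    have hexp : ∀ x : E, inner ℂ (b l) (polyOp T (f i j) x) =
        MvPolynomial.eval (s l) (f i j) * inner ℂ (b l) x := fun x => by
      conv_lhs => rw [← b.sum_repr' x]
      rw [map_sum, inner_sum, Finset.sum_eq_single l]
      · rw [map_smul, polyOp_apply_of_eigenvector (fun i => hb l i), inner_smul_right,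
          inner_smul_right, b.inner_eq_one]
        ring
      · intro q _ hq
        rw [map_smul, polyOp_apply_of_eigenvector (fun i => hb q i), inner_smul_right,
          inner_smul_right, b.inner_eq_zero hq.symm]
        ring
      · simp
    exact hexp _
  simp_rw [hcoef]
  have h1 := ContinuousLinearMap.le_of_opNorm_le _
    (hM (s l) ⟨b l, b.orthonormal.ne_zero l, fun i => hb l i⟩)
    (WithLp.toLp 2 fun j => inner ℂ (b l) (c j))
  have h2 := pow_le_pow_left₀ (norm_nonneg _) h1 2
  rwa [mul_pow, EuclideanSpace.norm_sq_eq, EuclideanSpace.norm_sq_eq] at h2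

end Normal

/-! ### A discrete Toeplitz estimate -/

section Toeplitz

variable {Y : Type*} [NormedAddCommGroup Y] [InnerProductSpace ℂ Y]

/-- Parseval's identity on `ℤ/N`. -/
theorem sum_norm_sq_zmod_transform {N : ℕ} [NeZero N] (a : ZMod N → Y) :
    ∑ r : ZMod N, ‖∑ k : ZMod N, ZMod.stdAddChar (-(r * k)) • a k‖ ^ 2 =
      N * ∑ k : ZMod N, ‖a k‖ ^ 2 := by
  have h : (∑ r : ZMod N, inner ℂ (∑ k : ZMod N, ZMod.stdAddChar (-(r * k)) • a k)
      (∑ k : ZMod N, ZMod.stdAddChar (-(r * k)) • a k) : ℂ) =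
      N * ∑ k : ZMod N, inner ℂ (a k) (a k) := by
    have e : ∀ r : ZMod N, (inner ℂ (∑ k : ZMod N, ZMod.stdAddChar (-(r * k)) • a k)
        (∑ k : ZMod N, ZMod.stdAddChar (-(r * k)) • a k) : ℂ) =
        ∑ k, ∑ l, starRingEnd ℂ (ZMod.stdAddChar (-(r * k))) *
          (ZMod.stdAddChar (-(r * l)) * inner ℂ (a k) (a l)) := fun r => by
      rw [sum_inner]
      refine Finset.sum_congr rfl fun k _ => ?_
      rw [inner_sum]
      exact Finset.sum_congr rfl fun l _ => by rw [inner_smul_left, inner_smul_right]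
    simp_rw [e]
    rw [Finset.sum_comm, Finset.mul_sum]
    refine Finset.sum_congr rfl fun k _ => ?_
    rw [Finset.sum_comm]
    have h1 : ∀ l r : ZMod N, starRingEnd ℂ (ZMod.stdAddChar (-(r * k))) *
        (ZMod.stdAddChar (-(r * l)) * inner ℂ (a k) (a l)) =
        ZMod.stdAddChar (r * (k - l)) * inner ℂ (a k) (a l) := fun l r => by
      rw [← AddChar.map_neg_eq_conj, ← mul_assoc, ← AddChar.map_add_eq_mul]
      congr 2
      ring
    have h2 : ∀ l, ∑ r : ZMod N, ZMod.stdAddChar (r * (k - l)) * inner ℂ (a k) (a l) =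
        if k = l then (N : ℂ) * inner ℂ (a k) (a l) else 0 := fun l => by
      rw [← Finset.sum_mul, AddChar.sum_mulShift _ (ZMod.isPrimitive_stdAddChar N)]
      simp only [sub_eq_zero, ZMod.card]
      split_ifs <;> simp
    simp_rw [h1, h2]
    simp
  apply Complex.ofReal_injective
  push_cast
  simp only [inner_self_eq_norm_sq_to_K] at h
  exact h

/-- The finite Fourier transform turns the cyclic convolution into multiplication by the symbol at
roots of unity, and Parseval's identity finishes. -/
theorem sum_norm_sq_zmod_le {N D : ℕ} [NeZero N] (C : ℕ → (Y →L[ℂ] Y)) {M : ℝ}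
    (hM : ∀ p : ℂ, ‖p‖ = 1 → ‖∑ d ∈ Finset.range D, p ^ d • C d‖ ≤ M) (a : ZMod N → Y) :
    ∑ k : ZMod N, ‖∑ d ∈ Finset.range D, C d (a (k + d))‖ ^ 2 ≤
      M ^ 2 * ∑ k : ZMod N, ‖a k‖ ^ 2 := by
  have hN : (0 : ℝ) < N := by exact_mod_cast Nat.pos_of_ne_zero (NeZero.ne N)
  refine le_of_mul_le_mul_left ?_ hN
  rw [← sum_norm_sq_zmod_transform, mul_left_comm, ← sum_norm_sq_zmod_transform, Finset.mul_sum]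
  refine Finset.sum_le_sum fun r _ => ?_
  have h : ∑ k : ZMod N, ZMod.stdAddChar (-(r * k)) • ∑ d ∈ Finset.range D, C d (a (k + d)) =
      (∑ d ∈ Finset.range D, (ZMod.stdAddChar r : ℂ) ^ d • C d)
        (∑ k : ZMod N, ZMod.stdAddChar (-(r * k)) • a k) := by
    rw [sum_apply]
    simp_rw [Finset.smul_sum]
    rw [Finset.sum_comm]
    refine Finset.sum_congr rfl fun d _ => ?_
    simp only [smul_apply, map_sum, map_smul]
    refine Eq.trans ?_ (Equiv.sum_comp (Equiv.addRight (d : ZMod N)) fun k =>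
      (ZMod.stdAddChar (-(r * k)) : ℂ) • (ZMod.stdAddChar r : ℂ) ^ d • C d (a k))
    refine Finset.sum_congr rfl fun k _ => ?_
    rw [Equiv.coe_addRight, smul_smul, ← AddChar.map_nsmul_eq_pow, ← AddChar.map_add_eq_mul]
    congr 2
    rw [nsmul_eq_mul]; ring
  rw [h, ← mul_pow]
  exact pow_le_pow_left₀ (norm_nonneg _) (ContinuousLinearMap.le_of_opNorm_le _
    (hM _ (AddChar.norm_apply _ _)) _) 2

/-- Wrap a window of length `K + D + 1` onto a cyclic group. For `k < K` and `d < D` the index `k +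
d` does not wrap around; the `1` keeps the group finite when `K = D = 0`. -/
theorem sum_norm_sq_toeplitz_le {K D : ℕ} (C : ℕ → (Y →L[ℂ] Y)) {M : ℝ}
    (hM : ∀ p : ℂ, ‖p‖ = 1 → ‖∑ d ∈ Finset.range D, p ^ d • C d‖ ≤ M) (x : ℕ → Y) :
    ∑ k ∈ Finset.range K, ‖∑ d ∈ Finset.range D, C d (x (k + d))‖ ^ 2 ≤
      M ^ 2 * ∑ k ∈ Finset.range (K + D + 1), ‖x k‖ ^ 2 := by
  have h := sum_norm_sq_zmod_le (N := K + D + 1) C hM fun k => x k.val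
  have hval : ∀ k, k < K + D + 1 → ((k : ℕ) : ZMod (K + D + 1)).val = k := fun k hk =>
    ZMod.val_cast_of_lt hk
  have hsum : ∀ g : ZMod (K + D + 1) → ℝ,
      ∑ k : ZMod (K + D + 1), g k = ∑ k ∈ Finset.range (K + D + 1), g k := fun g => by
    refine Finset.sum_nbij' (fun k => k.val) (fun k => (k : ZMod (K + D + 1)))
      (fun k _ => Finset.mem_range.mpr (ZMod.val_lt k)) (fun _ _ => Finset.mem_univ _)
      (fun k _ => ZMod.natCast_zmod_val k) (fun k hk => hval k (Finset.mem_range.mp hk))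
      (fun k _ => by rw [ZMod.natCast_zmod_val])
  rw [hsum, hsum] at h
  refine le_trans ?_ (h.trans (le_of_eq ?_))
  · refine le_trans (le_of_eq ?_) (Finset.sum_le_sum_of_subset_of_nonneg
      (Finset.range_mono (show K ≤ K + D + 1 by omega)) fun k _ _ => by positivity)
    refine Finset.sum_congr rfl fun k hk => ?_
    congr 2
    refine Finset.sum_congr rfl fun d hd => ?_
    rw [← Nat.cast_add, hval]
    rw [Finset.mem_range] at hk hd
    omega
  · congr 1
    exact Finset.sum_congr rfl fun k hk => by rw [hval k (Finset.mem_range.mp hk)]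

end Toeplitz

/-! ### The backward-shift model -/

section Model

variable {H : Type*} [NormedAddCommGroup H] [InnerProductSpace ℂ H]
  {E : Type*} [NormedAddCommGroup E] [InnerProductSpace ℂ E]

/-- Operators on `E` acting entrywise on sequences. -/
def pointwiseOp (E : Type*) [NormedAddCommGroup E] [InnerProductSpace ℂ E] :
    (E →L[ℂ] E) →+* Module.End ℂ (ℕ → E) where
  toFun B := LinearMap.pi fun k => (B : E →ₗ[ℂ] E) ∘ₗ LinearMap.proj k
  map_one' := by ext; rfl
  map_mul' _ _ := by ext; rfl
  map_zero' := by ext; rfl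
  map_add' _ _ := by ext; rfl

/-- The backward shift on sequences. -/
def backwardShift (E : Type*) [NormedAddCommGroup E] [InnerProductSpace ℂ E] :
    Module.End ℂ (ℕ → E) := LinearMap.funLeft ℂ E Nat.succ

theorem backwardShift_pow_apply (d : ℕ) (y : ℕ → E) (k : ℕ) :
    (backwardShift E ^ d) y k = y (k + d) := by
  induction d generalizing k with
  | zero => rfl
  | succ d ih =>
    rw [pow_succ', Module.End.mul_apply]
    change (backwardShift E ^ d) y (k + 1) = _
    rw [ih]
    congr 1
    omega

/-- Operator-coefficient polynomials acting on sequences, the variable being the backward shift. -/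
noncomputable def seqEval (E : Type*) [NormedAddCommGroup E] [InnerProductSpace ℂ E] :
    Polynomial (E →L[ℂ] E) →+* Module.End ℂ (ℕ → E) :=
  Polynomial.eval₂RingHom' (pointwiseOp E) (backwardShift E) fun _ => by
    ext; rfl

/-- Evaluation of operator-coefficient polynomials at a scalar. -/
noncomputable def scalarEval (E : Type*) [NormedAddCommGroup E] [InnerProductSpace ℂ E] (p : ℂ) :
    Polynomial (E →L[ℂ] E) →+* (E →L[ℂ] E) :=
  Polynomial.eval₂RingHom' (RingHom.id _) (algebraMap ℂ (E →L[ℂ] E) p) fun _ =>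
    (Algebra.commutes _ _).symm

theorem seqEval_apply (c : Polynomial (E →L[ℂ] E)) {D : ℕ} (hD : c.natDegree < D) (y : ℕ → E)
    (k : ℕ) : seqEval E c y k = ∑ d ∈ Finset.range D, c.coeff d (y (k + d)) := by
  change (Polynomial.eval₂ (pointwiseOp E) (backwardShift E) c) y k = _
  rw [Polynomial.eval₂_eq_sum_range' _ hD, LinearMap.sum_apply, Finset.sum_apply]
  refine Finset.sum_congr rfl fun d _ => ?_
  rw [Module.End.mul_apply]
  change c.coeff d ((backwardShift E ^ d) y k) = _
  rw [backwardShift_pow_apply]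

theorem scalarEval_eq (c : Polynomial (E →L[ℂ] E)) {D : ℕ} (hD : c.natDegree < D) (p : ℂ) :
    scalarEval E p c = ∑ d ∈ Finset.range D, p ^ d • c.coeff d := by
  change Polynomial.eval₂ _ _ c = _
  rw [Polynomial.eval₂_eq_sum_range' _ hD]
  refine Finset.sum_congr rfl fun d _ => ?_
  rw [RingHom.id_apply, ← map_pow, ← Algebra.commutes, ← Algebra.smul_def]

/-- The orbit map `h ↦ (δ P^k h)_k`. -/
def orbitMap (P : H →L[ℂ] H) (δ : H →L[ℂ] E) : H →ₗ[ℂ] (ℕ → E) :=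
  LinearMap.pi fun k => ((δ ∘L (P ^ k) : H →L[ℂ] E) : H →ₗ[ℂ] E)

theorem orbitMap_apply (P : H →L[ℂ] H) (δ : H →L[ℂ] E) (h : H) (k : ℕ) :
    orbitMap P δ h k = δ ((P ^ k) h) := rfl

/-- Pairs of an operator on `H` and an operator function that are intertwined by the orbit map
through an operator-coefficient polynomial. -/
noncomputable def modelAlgebra (P : H →L[ℂ] H) (δ : H →L[ℂ] E) :
    Subalgebra ℂ ((H →L[ℂ] H) × (ℂ → (E →L[ℂ] E))) where
  carrier := {q | ∃ c : Polynomial (E →L[ℂ] E),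
    (∀ h, orbitMap P δ (q.1 h) = seqEval E c (orbitMap P δ h)) ∧ ∀ p, q.2 p = scalarEval E p c}
  mul_mem' := by
    rintro ⟨A, g⟩ ⟨A', g'⟩ ⟨c, h1, h2⟩ ⟨c', h1', h2'⟩
    refine ⟨c * c', fun h => ?_, fun p => ?_⟩
    · rw [map_mul, Module.End.mul_apply, ← h1', ← h1]; rfl
    · rw [map_mul, ← h2, ← h2']; rfl
  add_mem' := by
    rintro ⟨A, g⟩ ⟨A', g'⟩ ⟨c, h1, h2⟩ ⟨c', h1', h2'⟩
    refine ⟨c + c', fun h => ?_, fun p => ?_⟩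
    · rw [map_add, LinearMap.add_apply, ← h1', ← h1, ← map_add]; rfl
    · rw [map_add, ← h2, ← h2']; rfl
  algebraMap_mem' r := by
    refine ⟨Polynomial.C (algebraMap ℂ (E →L[ℂ] E) r), fun h => ?_, fun p => ?_⟩
    · have : (algebraMap ℂ ((H →L[ℂ] H) × (ℂ → (E →L[ℂ] E))) r).1 h = r • h := by
        simp [Algebra.algebraMap_eq_smul_one]
      rw [this, map_smul]
      funext k
      rw [seqEval_apply (D := 1) _ (by simp)]
      simp [Algebra.algebraMap_eq_smul_one]
    · rw [scalarEval_eq (D := 1) _ (by simp)]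
      simp

/-- The intertwining polynomial is `B + C X`. Commutation with `P` propagates the relation for `δ`
along the orbit. -/
theorem mem_modelAlgebra_affine {P : H →L[ℂ] H} {δ : H →L[ℂ] E} {A : H →L[ℂ] H}
    (hA : Commute A P) {B C : E →L[ℂ] E} (h : ∀ x, δ (A x) = B (δ x) + C (δ (P x))) :
    (A, fun p => B + p • C) ∈ modelAlgebra P δ := by
  have hdeg : (Polynomial.C B + Polynomial.C C * Polynomial.X).natDegree < 2 :=
    lt_of_le_of_lt (by rw [add_comm]; exact Polynomial.natDegree_linear_le) one_lt_two
  refine ⟨Polynomial.C B + Polynomial.C C * Polynomial.X, fun x => ?_, fun p => ?_⟩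
  · funext k
    rw [seqEval_apply _ hdeg]
    have h1 : (P ^ k) (A x) = A ((P ^ k) x) := DFunLike.congr_fun (hA.pow_right k).eq.symm x
    have h2 : (P ^ (k + 1)) x = P ((P ^ k) x) := by rw [pow_succ']; rfl
    rw [Finset.sum_range_succ, Finset.sum_range_one, orbitMap_apply, orbitMap_apply,
      orbitMap_apply, h1, h, h2]
    simp [Polynomial.coeff_C]
  · rw [scalarEval_eq _ hdeg]
    simp [Finset.sum_range_succ, Polynomial.coeff_C]

theorem polyOp_mem_modelAlgebra {P : H →L[ℂ] H} {δ : H →L[ℂ] E} {n : ℕ} {S : Fin n → (H →L[ℂ] H)}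
    {T : ℂ → Fin n → (E →L[ℂ] E)} (h : ∀ i, (S i, fun p => T p i) ∈ modelAlgebra P δ)
    (f : MvPolynomial (Fin n) ℂ) :
    (polyOp S f, fun p => polyOp (T p) f) ∈ modelAlgebra P δ := by
  -- The pair is the same polynomial evaluated in the product algebra, so it lies in any subalgebra
  -- containing the generators.
  have heq : (polyOp S f, fun p => polyOp (T p) f) = ∑ d ∈ f.support, MvPolynomial.coeff d f •
      (List.ofFn fun i => ((S i, fun p => T p i) :
        (H →L[ℂ] H) × (ℂ → (E →L[ℂ] E))) ^ d i).prod := by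
    refine Prod.ext ?_ ?_
    · rw [← RingHom.coe_fst, map_sum]
      refine Finset.sum_congr rfl fun d _ => ?_
      rw [RingHom.coe_fst, Prod.smul_fst, ← RingHom.coe_fst, map_list_prod, List.map_ofFn]
      rfl
    · funext p
      have hev : ∀ l : List (ℂ → (E →L[ℂ] E)), l.prod p = (l.map fun g => g p).prod := fun l =>
        map_list_prod (Pi.evalRingHom (fun _ : ℂ => E →L[ℂ] E) p) l
      rw [← RingHom.coe_snd, map_sum, Finset.sum_apply]
      refine Finset.sum_congr rfl fun d _ => ?_
      rw [RingHom.coe_snd, Prod.smul_snd, Pi.smul_apply, ← RingHom.coe_snd, map_list_prod,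
        List.map_ofFn, hev, List.map_ofFn]
      rfl
  rw [heq]
  refine Subalgebra.sum_mem _ fun d _ => Subalgebra.smul_mem _
    (Subalgebra.list_prod_mem _ fun q hq => ?_) _
  obtain ⟨i, rfl⟩ := (List.mem_ofFn' _ _).mp hq
  exact Subalgebra.pow_mem _ (h i) _

theorem sum_norm_sq_orbit {P : H →L[ℂ] H} {δ : H →L[ℂ] E}
    (hδ : ∀ h, ‖δ h‖ ^ 2 = ‖h‖ ^ 2 - ‖P h‖ ^ 2) (h : H) (K : ℕ) :
    ∑ k ∈ Finset.range K, ‖orbitMap P δ h k‖ ^ 2 = ‖h‖ ^ 2 - ‖(P ^ K) h‖ ^ 2 := by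
  induction K with
  | zero => simp
  | succ K ih =>
    rw [Finset.sum_range_succ, ih, orbitMap_apply, hδ, pow_succ' P]
    simp

/-- The von Neumann inequality from a backward-shift model. -/
theorem norm_matPolyOp_le_of_model {n k : ℕ} {P : H →L[ℂ] H} {δ : H →L[ℂ] E}
    {S : Fin n → (H →L[ℂ] H)} {T : ℂ → Fin n → (E →L[ℂ] E)}
    (hmem : ∀ i, (S i, fun p => T p i) ∈ modelAlgebra P δ)
    (hδ : ∀ h, ‖δ h‖ ^ 2 = ‖h‖ ^ 2 - ‖P h‖ ^ 2)
    (hpure : ∀ h, Filter.Tendsto (fun k : ℕ => (P ^ k) h) Filter.atTop (nhds 0))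
    (f : Matrix (Fin k) (Fin k) (MvPolynomial (Fin n) ℂ)) {M : ℝ} (hM0 : 0 ≤ M)
    (hM : ∀ p : ℂ, ‖p‖ = 1 → ‖matPolyOp (T p) f‖ ≤ M) : ‖matPolyOp S f‖ ≤ M := by
  choose c hc1 hc2 using fun i j => polyOp_mem_modelAlgebra hmem (f i j)
  obtain ⟨D, hD⟩ : ∃ D, ∀ i j, (c i j).natDegree < D := by
    refine ⟨(∑ i, ∑ j, (c i j).natDegree) + 1, fun i j => Nat.lt_succ_of_le ?_⟩
    exact (Finset.single_le_sum (f := fun j => (c i j).natDegree) (fun _ _ => Nat.zero_le _)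
      (Finset.mem_univ j)).trans (Finset.single_le_sum
        (f := fun i => ∑ j, (c i j).natDegree) (fun _ _ => Nat.zero_le _) (Finset.mem_univ i))
  let C : ℕ → (PiLp 2 (fun _ : Fin k => E) →L[ℂ] PiLp 2 (fun _ : Fin k => E)) := fun d =>
    blockOp (Matrix.of fun i j => (c i j).coeff d)
  have hC : ∀ p, ∑ d ∈ Finset.range D, p ^ d • C d = matPolyOp (T p) f := by
    intro p
    ext x i
    rw [matPolyOp, blockOp_apply, sum_apply, WithLp.ofLp_sum, Finset.sum_apply]
    simp only [Matrix.map_apply, smul_apply, PiLp.smul_apply, C, blockOp_apply, Matrix.of_apply,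
      Finset.smul_sum]
    rw [Finset.sum_comm]
    refine Finset.sum_congr rfl fun j _ => ?_
    have := hc2 i j p
    simp only at this
    rw [this, scalarEval_eq _ (hD i j), sum_apply]
    rfl
  let orb : PiLp 2 (fun _ : Fin k => H) → ℕ → PiLp 2 (fun _ : Fin k => E) := fun h l =>
    WithLp.toLp 2 fun i => orbitMap P δ (h i) l
  have horb : ∀ h K, ∑ l ∈ Finset.range K, ‖orb h l‖ ^ 2 =
      ‖h‖ ^ 2 - ∑ i, ‖(P ^ K) (h i)‖ ^ 2 := by
    intro h K
    simp_rw [PiLp.norm_sq_eq_of_L2]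
    rw [Finset.sum_comm, ← Finset.sum_sub_distrib]
    exact Finset.sum_congr rfl fun i _ => sum_norm_sq_orbit hδ (h i) K
  have hint : ∀ h l, orb (matPolyOp S f h) l = ∑ d ∈ Finset.range D, C d (orb h (l + d)) := by
    intro h l
    ext i
    rw [WithLp.ofLp_sum, Finset.sum_apply]
    simp only [C, blockOp_apply, Matrix.of_apply, orb]
    rw [Finset.sum_comm, matPolyOp, blockOp_apply, map_sum, Finset.sum_apply]
    refine Finset.sum_congr rfl fun j _ => ?_
    rw [Matrix.map_apply, ← seqEval_apply _ (hD i j), ← hc1]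
  refine ContinuousLinearMap.opNorm_le_bound _ hM0 fun h => ?_
  rw [← sq_le_sq₀ (norm_nonneg _) (by positivity), mul_pow]
  -- Compare truncated orbits: telescoping evaluates the norm of the left one up to a `P ^ K` term
  -- that vanishes as `K → ∞`, and bounds the longer right one by `‖h‖ ^ 2`.
  have hle : ∀ K, ‖matPolyOp S f h‖ ^ 2 - ∑ i, ‖(P ^ K) (matPolyOp S f h i)‖ ^ 2 ≤
      M ^ 2 * ‖h‖ ^ 2 := by
    intro K
    rw [← horb]
    simp_rw [hint]
    refine (sum_norm_sq_toeplitz_le C (fun p hp => by rw [hC]; exact hM p hp) (orb h)).trans ?_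
    refine mul_le_mul_of_nonneg_left ?_ (sq_nonneg M)
    rw [horb]
    exact sub_le_self _ (Finset.sum_nonneg fun i _ => by positivity)
  have hlim : Filter.Tendsto (fun K => ‖matPolyOp S f h‖ ^ 2 -
      ∑ i, ‖(P ^ K) (matPolyOp S f h i)‖ ^ 2) Filter.atTop (nhds (‖matPolyOp S f h‖ ^ 2)) := by
    have h0 : Filter.Tendsto (fun K => ∑ i, ‖(P ^ K) (matPolyOp S f h i)‖ ^ 2) Filter.atTop
        (nhds (∑ _i : Fin k, (0 : ℝ))) :=
      tendsto_finsetSum _ fun i _ => by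
        simpa using ((hpure (matPolyOp S f h i)).norm.pow 2)
    simpa using tendsto_const_nhds.sub h0
  exact le_of_tendsto' hlim hle

end Model

/-! ### Defect operators and fundamental operators -/

section Defect

open ContinuousLinearMap

variable {H : Type*} [NormedAddCommGroup H] [InnerProductSpace ℂ H] [CompleteSpace H]

theorem isSelfAdjoint_defectOp (P : H →L[ℂ] H) : IsSelfAdjoint (defectOp P) :=
  IsSelfAdjoint.of_nonneg (CFC.sqrt_nonneg _)

theorem defectOp_mul_self {P : H →L[ℂ] H} (hP : ‖P‖ ≤ 1) :
    defectOp P * defectOp P = 1 - adjoint P * P := by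
  refine CFC.sqrt_mul_sqrt_self _ ?_
  rw [ContinuousLinearMap.nonneg_iff_isPositive, ContinuousLinearMap.isPositive_def']
  refine ⟨?_, fun x => ?_⟩
  · simp [IsSelfAdjoint, star_sub, star_mul, star_eq_adjoint]
  · have h1 : ‖P x‖ ≤ ‖x‖ := by
      simpa using le_of_opNorm_le P hP x
    have h2 : ‖P x‖ ^ 2 ≤ ‖x‖ ^ 2 := pow_le_pow_left₀ (norm_nonneg _) h1 2
    have h3 : inner ℂ (adjoint P (P x)) x = inner ℂ (P x) (P x) := adjoint_inner_left _ _ _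
    simp only [reApplyInnerSelf, sub_apply, one_apply_eq_self, mul_apply_eq_comp, inner_sub_left,
      h3, map_sub, inner_self_eq_norm_sq]
    linarith

theorem coe_defectMap (P : H →L[ℂ] H) (h : H) : (defectMap P h : H) = defectOp P h := rfl

theorem inner_defectMap {P : H →L[ℂ] H} (hP : ‖P‖ ≤ 1) (g h : H) :
    inner ℂ (defectMap P g) (defectMap P h) = inner ℂ g h - inner ℂ (P g) (P h) := by
  rw [Submodule.coe_inner, coe_defectMap, coe_defectMap,
    ← adjoint_inner_right, (isSelfAdjoint_iff'.mp (isSelfAdjoint_defectOp P))]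
  have := DFunLike.congr_fun (defectOp_mul_self hP) h
  rw [mul_apply_eq_comp] at this
  rw [this, sub_apply, inner_sub_right, one_apply_eq_self, mul_apply_eq_comp, adjoint_inner_right]

theorem norm_defectMap_sq {P : H →L[ℂ] H} (hP : ‖P‖ ≤ 1) (h : H) :
    ‖defectMap P h‖ ^ 2 = ‖h‖ ^ 2 - ‖P h‖ ^ 2 := by
  have h1 := congrArg Complex.re (inner_defectMap hP h h)
  have h2 : ∀ {K : Type _} [NormedAddCommGroup K] [InnerProductSpace ℂ K] (x : K),
      Complex.re (inner ℂ x x) = ‖x‖ ^ 2 := fun x => inner_self_eq_norm_sq (𝕜 := ℂ) x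
  rwa [Complex.sub_re, h2, h2, h2] at h1

theorem eq_zero_of_inner_defectMap {P : H →L[ℂ] H} {x : defectSpace P}
    (h : ∀ g, inner ℂ (defectMap P g) x = 0) : x = 0 := by
  have hx : (x : H) ∈ closure (Set.range (defectOp P)) := x.2
  have hcl : closure (Set.range (defectOp P)) ⊆ {y | inner ℂ y (x : H) = 0} := by
    refine closure_minimal ?_ (isClosed_eq (by fun_prop) continuous_const)
    rintro _ ⟨g, rfl⟩
    exact h g
  exact Subtype.ext (inner_self_eq_zero.mp (hcl hx))

/-- The intertwining relation `D_P S_i = F_i D_P + F_{n-i}^* D_P P`. -/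
theorem IsFundamentalTuple.defectMap_apply {m : ℕ} {S : Fin m → (H →L[ℂ] H)} {P : H →L[ℂ] H}
    [CompleteSpace (defectSpace P)]
    {F : Fin m → (defectSpace P →L[ℂ] defectSpace P)} (hF : IsFundamentalTuple S P F)
    (hP : ‖P‖ ≤ 1) (hSP : ∀ i, Commute (S i) P) (i : Fin m) (h : H) :
    defectMap P (S i h) = F i (defectMap P h) + adjoint (F i.rev) (defectMap P (P h)) := by
  -- This is the fundamental equation in weak form. The same identity for `i.rev`, conjugated, gives
  -- the term with the adjoint. Tested against the dense vectors `D_P g`, the two add up to `⟨D_P g,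
  -- D_P S_i h⟩`.
  have key : ∀ i g h, inner ℂ (defectMap P g) (F i (defectMap P h)) =
      inner ℂ g (S i h) - inner ℂ (S i.rev g) (P h) := by
    intro i g h
    have h1 := congrArg (inner ℂ g) (DFunLike.congr_fun (hF i) h)
    rw [sub_apply, mul_apply_eq_comp, inner_sub_right, adjoint_inner_right] at h1
    rw [h1, Submodule.coe_inner, coe_defectMap, ← adjoint_inner_right,
      (isSelfAdjoint_iff'.mp (isSelfAdjoint_defectOp P))]
    rfl
  rw [← sub_eq_zero]
  refine eq_zero_of_inner_defectMap fun g => ?_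
  have h2 : inner ℂ (defectMap P g) (adjoint (F i.rev) (defectMap P (P h))) =
      inner ℂ (S i.rev g) (P h) - inner ℂ (P g) (S i (P h)) := by
    rw [adjoint_inner_right, ← inner_conj_symm, key, Fin.rev_rev, map_sub, inner_conj_symm,
      inner_conj_symm]
  have h3 : S i (P h) = P (S i h) := DFunLike.congr_fun (hSP i).eq h
  rw [inner_sub_right, inner_add_right, key, h2, inner_defectMap hP, h3]
  ring

end Defect

/-! ### Adjoint pencils -/

section Adjoint

open ContinuousLinearMap

variable {E : Type*} [NormedAddCommGroup E] [InnerProductSpace ℂ E] [CompleteSpace E] {m : ℕ}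

theorem commute_adjoint {S T : E →L[ℂ] E} (h : Commute S T) :
    Commute (adjoint S) (adjoint T) := by
  have := congrArg adjoint h.eq
  rw [mul_def, mul_def, adjoint_comp, adjoint_comp] at this
  exact this.symm

theorem adjoint_pencil (A B : Fin m → (E →L[ℂ] E)) (p : ℂ) (i : Fin m) :
    ContinuousLinearMap.adjoint (pencil A B p i) =
      pencil (fun i => ContinuousLinearMap.adjoint (A i))
        (fun i => ContinuousLinearMap.adjoint (B i)) (starRingEnd ℂ p) i := by
  rw [pencil, map_add, map_smulₛₗ]
  rfl

/-- The relation `T_i = p T_{n-i}^*` passes to joint eigenvalues. -/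
theorem IsJointEigenvalue.eq_mul_conj_rev {T : Fin m → (E →L[ℂ] E)} {p : ℂ}
    (hT : ∀ i, T i = p • ContinuousLinearMap.adjoint (T i.rev)) {s : Fin m → ℂ}
    (hs : IsJointEigenvalue (fun i => (T i : Module.End ℂ E)) s) (i : Fin m) :
    s i = p * starRingEnd ℂ (s i.rev) := by
  obtain ⟨v, hv0, hv⟩ := hs
  have hv' : ∀ i, T i v = s i • v := hv
  -- Pairing with the eigenvector avoids having to know how the adjoint acts on it.
  have h1 : inner ℂ v (T i v) = p * inner ℂ (T i.rev v) v := by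
    conv_lhs => rw [hT i]
    rw [smul_apply, inner_smul_right, adjoint_inner_right]
  rw [hv', hv', inner_smul_right, inner_smul_left, ← mul_assoc] at h1
  exact mul_right_cancel₀ (inner_self_ne_zero.mpr hv0) h1

theorem pencil_eq_smul_adjoint_rev (A : Fin m → (E →L[ℂ] E)) {p : ℂ} (hp : ‖p‖ = 1)
    (i : Fin m) :
    pencil A (fun i => ContinuousLinearMap.adjoint (A i.rev)) p i =
      p • ContinuousLinearMap.adjoint
        (pencil A (fun i => ContinuousLinearMap.adjoint (A i.rev)) p i.rev) := by
  have h : p * starRingEnd ℂ p = 1 := by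
    rw [Complex.mul_conj, Complex.normSq_eq_norm_sq, hp]; simp
  rw [adjoint_pencil, pencil, pencil, smul_add, smul_smul, h, one_smul, adjoint_adjoint,
    Fin.rev_rev, add_comm]

variable [FiniteDimensional ℂ E]

/-- The joint eigenvalues of the adjoint tuple are the conjugates of those of the tuple. -/
theorem IsJointEigenvalue.adjoint {T : Fin m → (E →L[ℂ] E)} (hT : ∀ i j, Commute (T i) (T j))
    {s : Fin m → ℂ} (hs : IsJointEigenvalue (fun i => (T i : Module.End ℂ E)) s) :
    IsJointEigenvalue (fun i => (ContinuousLinearMap.adjoint (T i) : Module.End ℂ E))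
      fun i => starRingEnd ℂ (s i) := by
  have hEnd : ∀ {T : Fin m → (E →L[ℂ] E)}, (∀ i j, Commute (T i) (T j)) →
      ∀ i j, Commute (T i : Module.End ℂ E) (T j : Module.End ℂ E) := fun h i j =>
    LinearMap.ext fun x => DFunLike.congr_fun (h i j).eq x
  -- The tuple need not be normal, so the eigenvector itself does not serve for the adjoints.
  -- Non-invertibility of all linear combinations does pass to adjoints.
  rw [isJointEigenvalue_iff _ (hEnd fun i j => commute_adjoint (hT i j))]
  rw [isJointEigenvalue_iff _ (hEnd hT)] at hs
  intro a ha
  refine hs (fun i => starRingEnd ℂ (a i)) ?_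
  have hstar : ∀ A : E →L[ℂ] E, star (ContinuousLinearMap.adjoint A : Module.End ℂ E) = A :=
    fun A => by
      rw [LinearMap.star_eq_adjoint, eq_comm, LinearMap.eq_adjoint_iff]
      exact fun x y => (ContinuousLinearMap.adjoint_inner_right A x y).symm
  have := ha.star
  rw [star_sum] at this
  simpa only [star_smul, star_sub, hstar, star_one, RCLike.star_def, RCLike.conj_conj] using this

theorem IsDistinguishedPencil.adjoint {A B : Fin m → (E →L[ℂ] E)}
    (h : IsDistinguishedPencil A B) :
    IsDistinguishedPencil (fun i => ContinuousLinearMap.adjoint (A i))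
      fun i => ContinuousLinearMap.adjoint (B i) := by
  have hcomm : ∀ p : ℂ, ‖p‖ ≤ 1 → ∀ i j,
      Commute (pencil (fun i => ContinuousLinearMap.adjoint (A i))
        (fun i => ContinuousLinearMap.adjoint (B i)) p i)
        (pencil (fun i => ContinuousLinearMap.adjoint (A i))
        (fun i => ContinuousLinearMap.adjoint (B i)) p j) := fun p hp i j => by
    rw [← RCLike.conj_conj p, ← adjoint_pencil, ← adjoint_pencil]
    exact commute_adjoint (h.comm _ (by simpa using hp) i j)
  have hp' : ∀ (p : ℂ) (i : Fin m), ContinuousLinearMap.adjoint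
      (pencil (fun i => ContinuousLinearMap.adjoint (A i))
        (fun i => ContinuousLinearMap.adjoint (B i)) p i) = pencil A B (starRingEnd ℂ p) i :=
    fun p i => by simp [adjoint_pencil]
  refine ⟨hcomm, fun p hp s hs => ?_, fun s hs => ?_⟩
  · have h1 := hs.adjoint (hcomm p hp.le)
    simp only [hp'] at h1
    have h2 := torusSym_conj (h.circle _ (by simpa using hp) _ h1)
    convert h2 using 1
    funext i
    induction i using Fin.lastCases with
    | last => simp
    | cast i => simp
  · have h1 := hs.adjoint (T := fun i => ContinuousLinearMap.adjoint (A i))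
      (by simpa only [pencil_zero] using hcomm 0 (by simp))
    simp only [adjoint_adjoint] at h1
    simpa using openSym_conj (h.center _ h1)

/-- The pencil of the adjoint fundamental tuple is distinguished. -/
theorem isDistinguishedPencil_of_isGammaContraction {F : Fin m → (E →L[ℂ] E)}
    (h1 : ∀ z : ℂ, ‖z‖ ≤ 1 → IsGammaContraction fun i : Fin m =>
      (((m : ℂ) - (i : ℕ)) / ((m : ℂ) + 1)) •
        (ContinuousLinearMap.adjoint (F i) + z • F i.rev))
    (h2 : taylorSpectrum F ⊆ openSym m) :
    IsDistinguishedPencil (fun i => ContinuousLinearMap.adjoint (F i)) fun i => F i.rev := by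
  have hc : ∀ i : Fin m, ((m : ℂ) - (i : ℕ)) / ((m : ℂ) + 1) ≠ 0 := fun i => by
    refine div_ne_zero (sub_ne_zero.mpr ?_) (by exact_mod_cast Nat.succ_ne_zero m)
    exact_mod_cast i.2.ne'
  have hcomm : ∀ z : ℂ, ‖z‖ ≤ 1 → ∀ i j,
      Commute (pencil (fun i => ContinuousLinearMap.adjoint (F i)) (fun i => F i.rev) z i)
        (pencil (fun i => ContinuousLinearMap.adjoint (F i)) (fun i => F i.rev) z j) :=
    fun z hz i j => by
      -- The binomial-type weights are nonzero and can be cancelled from the commutation relations.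
      have h3 := ((h1 z hz).1 i j).smul_left (((m : ℂ) - (i : ℕ)) / ((m : ℂ) + 1))⁻¹
      have h4 := h3.smul_right (((m : ℂ) - (j : ℕ)) / ((m : ℂ) + 1))⁻¹
      rwa [inv_smul_smul₀ (hc i), inv_smul_smul₀ (hc j)] at h4
  refine ⟨hcomm, fun p hp s hs => ?_, fun s hs => ?_⟩
  · refine snoc_mem_torusSym hp (fun i => hs.eq_mul_conj_rev (fun i => ?_) i) ?_
    · have := pencil_eq_smul_adjoint_rev (fun i => ContinuousLinearMap.adjoint (F i)) hp i
      simpa only [adjoint_adjoint] using this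
    · apply (h1 p hp.le).2.1
      rw [mem_taylorSpectrum_iff _ (h1 p hp.le).1]
      obtain ⟨v, hv0, hv⟩ := hs
      refine ⟨v, hv0, fun i => ?_⟩
      have hv' : (ContinuousLinearMap.adjoint (F i) + p • F i.rev) v = s i • v := hv i
      change (((m : ℂ) - (i : ℕ)) / ((m : ℂ) + 1)) •
        (ContinuousLinearMap.adjoint (F i) + p • F i.rev) v = _
      rw [hv', smul_smul]
  -- Over the centre the pencil is `F^*`, whereas the hypothesis concerns `F`; `𝔾` is invariant
  -- under conjugation.
  · have h0 := hcomm 0 (by simp)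
    rw [pencil_zero] at h0
    have hF : ∀ i j, Commute (F i) (F j) := fun i j => by
      simpa only [adjoint_adjoint] using commute_adjoint (h0 i j)
    have h3 := hs.adjoint (T := fun i => ContinuousLinearMap.adjoint (F i)) h0
    simp only [adjoint_adjoint] at h3
    simpa using openSym_conj (h2 ((mem_taylorSpectrum_iff F hF _).mpr h3))

/-- On the unit circle, the operators of a pencil `A_i + p A_{n-i}^*` satisfy the von Neumann
inequality over the variety of the pencil. -/
theorem IsDistinguishedPencil.norm_matPolyOp_le_of_norm_eq_one {A : Fin m → (E →L[ℂ] E)}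
    (h : IsDistinguishedPencil A fun i => ContinuousLinearMap.adjoint (A i.rev)) {k : ℕ}
    {f : Matrix (Fin k) (Fin k) (MvPolynomial (Fin (m + 1)) ℂ)} {M : ℝ} (hM0 : 0 ≤ M)
    (hM : ∀ x ∈ pencilVariety A (fun i => ContinuousLinearMap.adjoint (A i.rev)),
      matPolyNorm f x ≤ M) {p : ℂ} (hp : ‖p‖ = 1) :
    ‖matPolyOp (Fin.snoc (pencil A (fun i => ContinuousLinearMap.adjoint (A i.rev)) p) (p • 1) :
      Fin (m + 1) → (E →L[ℂ] E)) f‖ ≤ M := by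
  set B : Fin m → (E →L[ℂ] E) := fun i => ContinuousLinearMap.adjoint (A i.rev) with hB
  set T : Fin (m + 1) → (E →L[ℂ] E) := Fin.snoc (pencil A B p) (p • 1)
  have hTl : T (Fin.last m) = p • 1 := by simp [T]
  have hTi : ∀ i : Fin m, T i.castSucc = pencil A B p i := fun i => by simp [T]
  have hTc : ∀ i j, Commute (T i) (T j) := by
    intro i j
    induction i using Fin.lastCases with
    | last => rw [hTl]; exact (Commute.one_left _).smul_left _
    | cast i =>
      induction j using Fin.lastCases with
      | last => rw [hTl]; exact (Commute.one_right _).smul_right _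
      | cast j => rw [hTi, hTi]; exact h.comm p hp.le i j
  have hpp : starRingEnd ℂ p * p = 1 := by
    rw [mul_comm, Complex.mul_conj, Complex.normSq_eq_norm_sq, hp]; simp
  have hadjT : ∀ i j, Commute (T i) (ContinuousLinearMap.adjoint (T j)) := by
    intro i j
    induction j using Fin.lastCases with
    | last =>
      rw [hTl, map_smulₛₗ, ← star_eq_adjoint, star_one]
      exact (Commute.one_right _).smul_right _
    | cast j =>
      -- On the circle each adjoint is a scalar multiple of another member of the tuple, so
      -- commutativity already gives normality.
      have h1 : ContinuousLinearMap.adjoint (T j.castSucc) =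
          starRingEnd ℂ p • T j.rev.castSucc := by
        have h2 := pencil_eq_smul_adjoint_rev A hp j.rev
        rw [← hB, Fin.rev_rev] at h2
        rw [hTi, hTi, h2, smul_smul, hpp, one_smul]
      rw [h1]
      exact (hTc i _).smul_right _
  refine norm_matPolyOp_le_of_normal hTc hadjT f hM0 fun s hs => ?_
  obtain ⟨v, hv0, hv⟩ := hs
  have hv' : ∀ i, T i v = s i • v := hv
  have hlast : s (Fin.last m) = p := by
    have h3 := hv' (Fin.last m)
    rw [hTl] at h3
    exact (smul_left_injective ℂ hv0 h3).symm
  have h4 := h.matPolyNorm_le (f := f) hM0 hM hp (s := fun i => s i.castSucc)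
    ⟨v, hv0, fun i => by
      have h3 := hv' i.castSucc
      rw [hTi] at h3
      exact h3⟩
  rwa [← hlast, snoc_castSucc_last] at h4

/-- The von Neumann inequality over the variety of a pencil, for operators with a backward-shift
model over the pencil. -/
theorem IsDistinguishedPencil.norm_matPolyOp_le {H : Type*} [NormedAddCommGroup H]
    [InnerProductSpace ℂ H] {A : Fin m → (E →L[ℂ] E)}
    (h : IsDistinguishedPencil A fun i => ContinuousLinearMap.adjoint (A i.rev))
    {S : Fin m → (H →L[ℂ] H)} {P : H →L[ℂ] H} {δ : H →L[ℂ] E} (hSP : ∀ i, Commute (S i) P)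
    (hint : ∀ i x, δ (S i x) = A i (δ x) + ContinuousLinearMap.adjoint (A i.rev) (δ (P x)))
    (hδ : ∀ x, ‖δ x‖ ^ 2 = ‖x‖ ^ 2 - ‖P x‖ ^ 2)
    (hpure : ∀ x, Filter.Tendsto (fun k : ℕ => (P ^ k) x) Filter.atTop (nhds 0)) {k : ℕ}
    {f : Matrix (Fin k) (Fin k) (MvPolynomial (Fin (m + 1)) ℂ)} {M : ℝ} (hM0 : 0 ≤ M)
    (hM : ∀ x ∈ pencilVariety A (fun i => ContinuousLinearMap.adjoint (A i.rev)),
      matPolyNorm f x ≤ M) :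
    ‖matPolyOp (Fin.snoc S P : Fin (m + 1) → (H →L[ℂ] H)) f‖ ≤ M := by
  refine norm_matPolyOp_le_of_model (P := P) (δ := δ)
    (T := fun p => Fin.snoc (pencil A (fun i => ContinuousLinearMap.adjoint (A i.rev)) p) (p • 1))
    (fun i => ?_) hδ hpure f hM0 fun p hp => h.norm_matPolyOp_le_of_norm_eq_one hM0 hM hp
  induction i using Fin.lastCases with
  | last =>
    have h1 := mem_modelAlgebra_affine (Commute.refl P) (δ := δ) (B := 0) (C := 1) (by simp)
    simpa only [Fin.snoc_last, zero_add] using h1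
  | cast i =>
    have h1 := mem_modelAlgebra_affine (hSP i) (B := A i) (hint i)
    simpa only [Fin.snoc_castSucc] using! h1

end Adjoint

/-! ### Translation to the statement: spectra, contractivity and norms. -/

theorem pencilVariety_eq_setOf_taylorSpectrum {E : Type*} [NormedAddCommGroup E] [NormedSpace ℂ E]
    [FiniteDimensional ℂ E] {m : ℕ} {A B : Fin m → (E →L[ℂ] E)}
    (h : ∀ p : ℂ, ‖p‖ ≤ 1 → ∀ i j, Commute (pencil A B p i) (pencil A B p j)) :
    {x : Fin (m + 1) → ℂ | x ∈ openSym (m + 1) ∧ (fun i : Fin m => x i.castSucc) ∈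
      taylorSpectrum (pencil A B (x (Fin.last m)))} = pencilVariety A B := by
  ext x
  exact and_congr_right fun hx => mem_taylorSpectrum_iff _ (h _ (norm_last_lt_one hx).le) _

/-- Apply the spectral set inequality to the last coordinate function, which is bounded by `1` on
`Γ`. -/
theorem norm_le_one_of_isGammaContraction {m : ℕ} {H : Type*} [NormedAddCommGroup H]
    [NormedSpace ℂ H] {S : Fin m → (H →L[ℂ] H)} {P : H →L[ℂ] H}
    (h : IsGammaContraction (Fin.snoc S P : Fin (m + 1) → (H →L[ℂ] H))) : ‖P‖ ≤ 1 := by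
  have h1 := h.2.2 (MvPolynomial.X (Fin.last m))
  have h2 : polyOp (Fin.snoc S P : Fin (m + 1) → (H →L[ℂ] H)) (MvPolynomial.X (Fin.last m)) = P := by
    classical
    have hs : (MvPolynomial.X (Fin.last m) : MvPolynomial (Fin (m + 1)) ℂ).support =
      {Finsupp.single (Fin.last m) 1} := MvPolynomial.support_X
    rw [polyOp, hs, Finset.sum_singleton, MvPolynomial.coeff_X, if_pos rfl,
      one_smul, List.ofFn_succ_last, List.prod_append, List.prod_eq_one]
    · simp
    · intro x hx
      obtain ⟨i, rfl⟩ := (List.mem_ofFn' _ _).mp hx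
      simp
  rw [h2] at h1
  refine h1.trans (csSup_le ?_ ?_)
  · exact ⟨_, _, ⟨0, fun i => by simp, rfl⟩, rfl⟩
  · rintro _ ⟨x, hx, rfl⟩
    simpa using norm_last_le_one hx

theorem continuous_matPolyNorm {n k : ℕ} (f : Matrix (Fin k) (Fin k) (MvPolynomial (Fin n) ℂ)) :
    Continuous (matPolyNorm f) := by
  have h1 : Continuous fun x : Fin n → ℂ => f.map (MvPolynomial.eval x) :=
    continuous_matrix fun i j => continuous_eval_mvPolynomial (f i j)
  have h2 : Continuous fun A : Matrix (Fin k) (Fin k) ℂ =>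
      Matrix.toEuclideanCLM (n := Fin k) (𝕜 := ℂ) A :=
    LinearMap.continuous_of_finiteDimensional
      (Matrix.toEuclideanCLM (n := Fin k) (𝕜 := ℂ)).toAlgEquiv.toLinearMap
  exact (h2.comp h1).norm

theorem norm_polyOp_le_matPolyOp {n : ℕ} {H : Type*} [NormedAddCommGroup H] [NormedSpace ℂ H]
    (T : Fin n → (H →L[ℂ] H)) (f : MvPolynomial (Fin n) ℂ) :
    ‖polyOp T f‖ ≤ ‖matPolyOp T (Matrix.of fun _ _ : Fin 1 => f)‖ := by
  refine ContinuousLinearMap.opNorm_le_bound _ (norm_nonneg _) fun h => ?_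
  have h1 := (matPolyOp T (Matrix.of fun _ _ : Fin 1 => f)).le_opNorm (WithLp.toLp 2 fun _ => h)
  have h2 : ∀ y : PiLp 2 fun _ : Fin 1 => H, ‖y‖ = ‖y 0‖ := fun y => by
    simp [PiLp.norm_eq_of_L2]
  rw [h2, h2 (WithLp.toLp 2 fun _ => h), matPolyOp, blockOp_apply] at h1
  rw [← matPolyOp] at h1
  simpa using h1

theorem matPolyNorm_of_scalar {n : ℕ} (f : MvPolynomial (Fin n) ℂ) (x : Fin n → ℂ) :
    matPolyNorm (Matrix.of fun _ _ : Fin 1 => f) x = ‖MvPolynomial.eval x f‖ := by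
  have h : (Matrix.of fun _ _ : Fin 1 => f).map (MvPolynomial.eval x) =
      MvPolynomial.eval x f • (1 : Matrix (Fin 1) (Fin 1) ℂ) := by
    ext i j
    simp [Subsingleton.elim i j]
  rw [matPolyNorm, h, map_smul, map_one, norm_smul, norm_one, mul_one]

end SymPolydisc

theorem theorem7p1 {H : Type*} [NormedAddCommGroup H] [InnerProductSpace ℂ H] [CompleteSpace H]
    [Nontrivial H] {m : ℕ} (hm : 1 ≤ m) (S : Fin m → (H →L[ℂ] H)) (P : H →L[ℂ] H)
    (hS : SymPolydisc.IsGammaContraction (Fin.snoc S P : Fin (m + 1) → (H →L[ℂ] H)))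
    (hpure : SymPolydisc.IsPureGammaContraction
      (fun i => ContinuousLinearMap.adjoint (S i)) (ContinuousLinearMap.adjoint P))
    (hfin : FiniteDimensional ℂ (SymPolydisc.defectSpace P))
    (F : Fin m → (SymPolydisc.defectSpace P →L[ℂ] SymPolydisc.defectSpace P))
    (hF : SymPolydisc.IsFundamentalTuple S P F)
    (h1 : ∀ z : ℂ, ‖z‖ ≤ 1 → SymPolydisc.IsGammaContraction fun i : Fin m =>
      (((m : ℂ) - (i : ℕ)) / ((m : ℂ) + 1)) •
        (ContinuousLinearMap.adjoint (F i) + z • F i.rev))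
    (h2 : SymPolydisc.taylorSpectrum F ⊆ SymPolydisc.openSym m) :
    SymPolydisc.IsDistinguishedVariety (SymPolydisc.fiberVariety F) ∧
    SymPolydisc.IsDistinguishedVariety (SymPolydisc.adjointFiberVariety F) ∧
    (∀ f : MvPolynomial (Fin (m + 1)) ℂ,
      ∃ x ∈ closure (SymPolydisc.fiberVariety F),
        IsMaxOn (fun y => ‖MvPolynomial.eval y f‖) (closure (SymPolydisc.fiberVariety F)) x ∧
        ‖SymPolydisc.polyOp (Fin.snoc S P : Fin (m + 1) → (H →L[ℂ] H)) f‖ ≤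
          ‖MvPolynomial.eval x f‖) ∧
    (∀ (k : ℕ) (f : Matrix (Fin k) (Fin k) (MvPolynomial (Fin (m + 1)) ℂ)),
      ∃ x ∈ closure (SymPolydisc.fiberVariety F),
        IsMaxOn (SymPolydisc.matPolyNorm f) (closure (SymPolydisc.fiberVariety F)) x ∧
        ‖SymPolydisc.matPolyOp (Fin.snoc S P : Fin (m + 1) → (H →L[ℂ] H)) f‖ ≤
          SymPolydisc.matPolyNorm f x) := by
  open SymPolydisc in
  have hP : ‖P‖ ≤ 1 := norm_le_one_of_isGammaContraction hS
  have hSP : ∀ i, Commute (S i) P := fun i => by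
    simpa using hS.1 i.castSucc (Fin.last m)
  have hstrong : ∀ h, Filter.Tendsto (fun k : ℕ => (P ^ k) h) Filter.atTop (nhds 0) := by
    simpa only [ContinuousLinearMap.adjoint_adjoint] using hpure.2
  have hadj := isDistinguishedPencil_of_isGammaContraction h1 h2
  let B : Fin m → (defectSpace P →L[ℂ] defectSpace P) := fun i =>
    ContinuousLinearMap.adjoint (F i.rev)
  have hdist : IsDistinguishedPencil F B := by
    simpa only [ContinuousLinearMap.adjoint_adjoint] using hadj.adjoint
  have hV : fiberVariety F = pencilVariety F B := pencilVariety_eq_setOf_taylorSpectrum hdist.comm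
  have hV' : adjointFiberVariety F =
      pencilVariety (fun i => ContinuousLinearMap.adjoint (F i)) fun i => F i.rev :=
    pencilVariety_eq_setOf_taylorSpectrum hadj.comm
  -- With trivial defect space `P` would be isometric, against `P^k → 0` on `H ≠ 0`. Nontriviality
  -- makes the variety nonempty, so that the maximum exists.
  have hnt : Nontrivial (defectSpace P) := by
    obtain ⟨h, hh⟩ := exists_ne (0 : H)
    by_contra hnot
    rw [not_nontrivial_iff_subsingleton] at hnot
    have hiso : ∀ g, ‖P g‖ = ‖g‖ := fun g => by
      have h3 := norm_defectMap_sq hP g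
      rw [Subsingleton.elim (defectMap P g) 0, norm_zero] at h3
      exact (pow_left_inj₀ (norm_nonneg _) (norm_nonneg _) two_ne_zero).mp (by linarith)
    have hpow : ∀ k : ℕ, ‖(P ^ k) h‖ = ‖h‖ := fun k => by
      induction k with
      | zero => simp
      | succ k ih => rw [pow_succ', mul_apply_eq_comp, hiso, ih]
    have h4 := (hstrong h).norm
    simp only [hpow, norm_zero] at h4
    exact hh (norm_eq_zero.mp (tendsto_nhds_unique tendsto_const_nhds h4))
  have hne := hdist.pencilVariety_nonempty
  have hcpt := isCompact_closure_pencilVariety F B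
  have hmat : ∀ {k : ℕ} (f : Matrix (Fin k) (Fin k) (MvPolynomial (Fin (m + 1)) ℂ)) {M : ℝ},
      (∀ x ∈ pencilVariety F B, matPolyNorm f x ≤ M) →
        ‖matPolyOp (Fin.snoc S P : Fin (m + 1) → (H →L[ℂ] H)) f‖ ≤ M := by
    intro k f M hM
    -- Nonnegativity of `M` comes from a point of the variety.
    have hM0 : 0 ≤ M := (norm_nonneg _).trans (hM _ hne.some_mem)
    exact hdist.norm_matPolyOp_le hSP (hF.defectMap_apply hP hSP) (norm_defectMap_sq hP) hstrong hM0 hM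
  rw [hV, hV']
  refine ⟨hdist.isDistinguishedVariety, hadj.isDistinguishedVariety, fun f => ?_, fun k f => ?_⟩
  · obtain ⟨x, hx, hmax⟩ := hcpt.exists_isMaxOn hne.closure
      (continuous_eval_mvPolynomial f).norm.continuousOn
    refine ⟨x, hx, hmax, (norm_polyOp_le_matPolyOp _ f).trans (hmat _ fun y hy => ?_)⟩
    rw [matPolyNorm_of_scalar]
    exact hmax (subset_closure hy)
  · obtain ⟨x, hx, hmax⟩ := hcpt.exists_isMaxOn hne.closure (continuous_matPolyNorm f).continuousOn
    exact ⟨x, hx, hmax, hmat f fun y hy => hmax (subset_closure hy)⟩
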